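/- An access point with $N\ge 1$ antennas transmits a signal $x[l]\in\mathbb C^N$ in each timeslot $l=0,1,2,\dots$ to $K$ energy receivers with $M$ antennas each. The channel states $H[l]=(H_1[l],\dots,H_K[l])$, $H_i[l]\in\mathbb C^{M\times N}$, are i.i.d. over timeslots. Put $Q_i[l]=\eta\,\mathrm{Tr}(W_i[l]x[l]x[l]^H)$, where $W_i[l]=H_i[l]^HH_i[l]$ and $\eta\in[0,1]$ is the conversion efficiency, and assume that the received power never exceeds the transmitted power, i.e. almost surely $\eta\|H_i[l]v\|^2\le\|v\|^2$ for all $v\in\mathbb C^N$ and all $i,l$. Let $\phi:[0,\infty)^K\to[-\infty,\infty)$ be continuous, concave and non-decreasing, and finite at vectors with positive entries; let $P_{peak}>0$, $P_{min}\ge 0$, $V>0$ and $P_{avg}\in\mathbb R$. A policy chooses $x[l]$ as a measurable function of $(H[0],\dots,H[l])$. With $\bar Q_i^{(L)}=\frac1L\sum_{l<L}\mathbb E[Q_i[l]]$, it is feasible if (1) $\liminf_{L\to\infty}\bar Q_i^{(L)}\ge P_{min}$ for all $i$, (2) $\limsup_{L\to\infty}\frac1L\sum_{l<L}\mathbb E[\mathrm{Tr}(x[l]x[l]^H)]\le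 P_{avg}$, (3) $\mathrm{Tr}(x[l]x[l]^H)\le P_{peak}$ for all $l$. Assume that a feasible policy exists, and let $\bar Q_\phi^{Opt}$ be the supremum of $\limsup_{L\to\infty}\phi(\bar Q_1^{(L)},\dots,\bar Q_K^{(L)})$ over all feasible policies. The QF-WPT policy starts with $G_i[0]=Z_i[0]=Z_{AP}[0]=0$ and in timeslot $l$ does the following. It forms $W'[l]=\sum_{i=1}^K(Z_i[l]+G_i[l])\,\eta W_i[l]-Z_{AP}[l]I$. It sets $x[l]=\sqrt{P_{peak}}\,u$, with $u$ a unit eigenvector of $W'[l]$ for its largest eigenvalue, if that eigenvalue is $\ge0$, and $x[l]=0$ otherwise. It chooses $\gamma[l]$ as a minimizer of $-V\phi(\gamma)+\sum_iG_i[l]\gamma_i$ over $0\le\gamma_i\le P_{peak}$. Finally it updates $$G_i[l+1]=\max\{G_i[l]+\gamma_i[l]-Q_i[l],0\},\qquad Z_i[l+1]=\max\{Z_i[l]+P_{min}-Q_i[l],0\},$$ $$Z_{AP}[l+1]=\max\{Z_{AP}[l]+\mathrm{Tr}(x[l]x[l]^H)-P_{avg},0\}.$$ If there are several eigenvectors or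 minimizers, any choice that makes $x[l]$ and $\gamma[l]$ measurable functions of $(H[0],\dots,H[l])$ is allowed. Then (a) the QF-WPT policy is feasible, i.e. it satisfies (1), (2) and (3); and (b) with $B=\frac{2K+1}{2}P_{peak}^2$, its average received powers satisfy $$\bar Q_\phi^{Opt}-\frac BV\le\liminf_{L\to\infty}\phi(\bar Q_1^{(L)},\dots,\bar Q_K^{(L)})\le\limsup_{L\to\infty}\phi(\bar Q_1^{(L)},\dots,\bar Q_K^{(L)})\le\bar Q_\phi^{Opt}.$$ -/

import Mathlib

open MeasureTheory ProbabilityTheory Filter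

noncomputable section

namespace WPT

/-- Channel state of one timeslot: for each of the `K` receivers the `M × N` complex matrix from
the `N` transmit antennas to its `M` receive antennas. -/
abbrev Channel (K M N : ℕ) : Type := Fin K → Matrix (Fin M) (Fin N) ℂ

/-- Matrices carry the product (Borel) σ-algebra of their entries. -/
instance instMeasurableSpaceMatrix {M N : ℕ} : MeasurableSpace (Matrix (Fin M) (Fin N) ℂ) :=
  inferInstanceAs (MeasurableSpace (Fin M → Fin N → ℂ))

/-- Transmitted signal vectors, with the Euclidean norm, so that `Tr(x xᴴ) = ‖x‖ ^ 2`. -/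
abbrev Signal (N : ℕ) : Type := EuclideanSpace ℂ (Fin N)

/-- A rule with values in `α` that in timeslot `l` sees the channel states of slots `0, …, l`. -/
abbrev Causal (K M N : ℕ) (α : Type) : Type := (l : ℕ) → (Fin (l + 1) → Channel K M N) → α

/-- Numerical parameters: energy conversion efficiency `η`, peak and average transmit power
limits, minimum average received power of each receiver, and the control parameter `V`. -/
structure Params where
  η : ℝ
  Ppeak : ℝ
  Pavg : ℝ
  Pmin : ℝ
  V : ℝ

variable {K M N : ℕ}

/-- The channel history up to and including slot `l` of a sequence of channel states. -/
def hist (c : ℕ → Channel K M N) (l : ℕ) : Fin (l + 1) → Channel K M N := fun j => c j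

/-- The power `η ‖H x‖ ^ 2 = η Tr(Hᴴ H x xᴴ)` received through `H` when `x` is sent. -/
def recvPower (η : ℝ) (H : Matrix (Fin M) (Fin N) ℂ) (x : Signal N) : ℝ :=
  η * ‖Matrix.toEuclideanLin H x‖ ^ 2

/-- The nonnegative orthant `[0, ∞) ^ K`. -/
def orthant (K : ℕ) : Set (Fin K → ℝ) := {q | ∀ i, 0 ≤ q i}

/-- Network utility functions: `φ : [0, ∞) ^ K → [-∞, ∞)` that is continuous, concave and
non-decreasing, and finite at vectors with positive entries (so that for instance the sum of
logarithms is allowed). Values outside the orthant play no role. -/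
structure IsUtility (φ : (Fin K → ℝ) → EReal) : Prop where
  continuousOn : ContinuousOn φ (orthant K)
  monotoneOn : MonotoneOn φ (orthant K)
  concave : ∀ p ∈ orthant K, ∀ q ∈ orthant K, ∀ a b : ℝ, 0 < a → 0 < b → a + b = 1 →
    (a : EReal) * φ p + (b : EReal) * φ q ≤ φ (a • p + b • q)
  ne_top : ∀ q ∈ orthant K, φ q ≠ ⊤
  ne_bot : ∀ q : Fin K → ℝ, (∀ i, 0 < q i) → φ q ≠ ⊥

section Performance

variable {Ω : Type*} [MeasurableSpace Ω]

/-- `(1 / L) ∑_{l < L} E[η ‖H_i[l] x[l]‖ ^ 2]`, for each receiver `i`. -/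
def avgRecv (μ : Measure Ω) (H : ℕ → Ω → Channel K M N) (η : ℝ) (x : Causal K M N (Signal N))
    (L : ℕ) : Fin K → ℝ := fun i =>
  (1 / (L : ℝ)) * ∑ l ∈ Finset.range L,
    ∫ ω, recvPower η (H l ω i) (x l (hist (fun j => H j ω) l)) ∂μ

/-- `(1 / L) ∑_{l < L} E[‖x[l]‖ ^ 2]`. -/
def avgSent (μ : Measure Ω) (H : ℕ → Ω → Channel K M N) (x : Causal K M N (Signal N))
    (L : ℕ) : ℝ :=
  (1 / (L : ℝ)) * ∑ l ∈ Finset.range L, ∫ ω, ‖x l (hist (fun j => H j ω) l)‖ ^ 2 ∂μ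

/-- A (measurable) transmission policy that satisfies the minimum received power constraint of
every receiver and the average and peak transmit power constraints. -/
structure Feasible (P : Params) (μ : Measure Ω) (H : ℕ → Ω → Channel K M N)
    (x : Causal K M N (Signal N)) : Prop where
  measurable : ∀ l, Measurable (x l)
  minRecv : ∀ i, P.Pmin ≤ liminf (fun L => avgRecv μ H P.η x L i) atTop
  avgPower : limsup (fun L => avgSent μ H x L) atTop ≤ P.Pavg
  peakPower : ∀ l h, ‖x l h‖ ^ 2 ≤ P.Ppeak

/-- The optimal utility: the supremum over all feasible policies of the long-term utility
`φ (lim_L avgRecv L)`, read as the upper limit where the limit does not exist. -/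
def optUtility (P : Params) (μ : Measure Ω) (H : ℕ → Ω → Channel K M N)
    (φ : (Fin K → ℝ) → EReal) : EReal :=
  ⨆ (x : Causal K M N (Signal N)) (_ : Feasible P μ H x),
    limsup (fun L => φ (avgRecv μ H P.η x L)) atTop

end Performance

section Algorithm

/-- Virtual queues `G_i[l]` along the channel sequence `c`, for signals `x` and auxiliary
variables `γ`. -/
def queueG (P : Params) (x : Causal K M N (Signal N)) (γ : Causal K M N (Fin K → ℝ))
    (c : ℕ → Channel K M N) : ℕ → Fin K → ℝ
  | 0 => fun _ => 0
  | l + 1 => fun i => max (queueG P x γ c l i + γ l (hist c l) i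
      - recvPower P.η (c l i) (x l (hist c l))) 0

/-- Virtual queues `Z_i[l]`. -/
def queueZ (P : Params) (x : Causal K M N (Signal N)) (c : ℕ → Channel K M N) :
    ℕ → Fin K → ℝ
  | 0 => fun _ => 0
  | l + 1 => fun i => max (queueZ P x c l i + P.Pmin
      - recvPower P.η (c l i) (x l (hist c l))) 0

/-- Virtual queue `Z_AP[l]`. -/
def queueAP (P : Params) (x : Causal K M N (Signal N)) (c : ℕ → Channel K M N) : ℕ → ℝ
  | 0 => 0
  | l + 1 => max (queueAP P x c l + ‖x l (hist c l)‖ ^ 2 - P.Pavg) 0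

/-- `W' = ∑ i, (Z_i + G_i) W_i - Z_AP I` with `W_i = η H_iᴴ H_i`. -/
def weightedMatrix (η : ℝ) (H : Channel K M N) (G Z : Fin K → ℝ) (ZAP : ℝ) :
    Matrix (Fin N) (Fin N) ℂ :=
  ∑ i, (((Z i + G i) * η : ℝ) : ℂ) • ((H i).conjTranspose * H i)
    - (ZAP : ℂ) • (1 : Matrix (Fin N) (Fin N) ℂ)

/-- `t` is the largest eigenvalue of the (Hermitian) matrix `A`. -/
def IsMaxEigenvalue (A : Matrix (Fin N) (Fin N) ℂ) (t : ℝ) : Prop :=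
  IsGreatest {s : ℝ | Module.End.HasEigenvalue (Matrix.toEuclideanLin A) (s : ℂ)} t

/-- The beamforming rule: full power along a unit eigenvector of the largest eigenvalue of `A` if
that eigenvalue is nonnegative, and no transmission otherwise. -/
def IsBeam (Ppeak : ℝ) (A : Matrix (Fin N) (Fin N) ℂ) (x : Signal N) : Prop :=
  ∃ t : ℝ, IsMaxEigenvalue A t ∧
    (0 ≤ t → ∃ u : Signal N, ‖u‖ = 1 ∧
      Module.End.HasEigenvector (Matrix.toEuclideanLin A) (t : ℂ) u ∧
      x = ((Real.sqrt Ppeak : ℝ) : ℂ) • u) ∧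
    (t < 0 → x = 0)

/-- `γ` minimizes `-V φ(γ) + ∑ i, G_i γ_i` subject to `0 ≤ γ_i ≤ Ppeak`. -/
def IsAux (P : Params) (φ : (Fin K → ℝ) → EReal) (G γ : Fin K → ℝ) : Prop :=
  (∀ i, 0 ≤ γ i ∧ γ i ≤ P.Ppeak) ∧
    IsMinOn (fun g : Fin K → ℝ => -((P.V : EReal) * φ g) + ((∑ i, G i * g i : ℝ) : EReal))
      {g | ∀ i, 0 ≤ g i ∧ g i ≤ P.Ppeak} γ

/-- `x` and `γ` are the signals and auxiliary variables produced by the quality-of-service-aware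
fair policy (for an arbitrary measurable choice among several eigenvectors or minimizers). -/
structure IsQFWPT (P : Params) (φ : (Fin K → ℝ) → EReal)
    (x : Causal K M N (Signal N)) (γ : Causal K M N (Fin K → ℝ)) : Prop where
  measurable_signal : ∀ l, Measurable (x l)
  measurable_aux : ∀ l, Measurable (γ l)
  beam : ∀ (c : ℕ → Channel K M N) (l : ℕ),
    IsBeam P.Ppeak (weightedMatrix P.η (c l) (queueG P x γ c l) (queueZ P x c l)
      (queueAP P x c l)) (x l (hist c l))
  aux : ∀ (c : ℕ → Channel K M N) (l : ℕ), IsAux P φ (queueG P x γ c l) (γ l (hist c l))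

end Algorithm

end WPT

end

/-! The proof is a drift-plus-penalty argument for half the sum of the squared queues, using neither
a stationary randomized optimal policy nor a Slater condition. In one slot a squared queue grows by
at most twice the queue times (arrival minus service), plus `Ppeak ^ 2`; half of this over the `2K +
1` queues gives `B` (`lyapunov_succ_le`). The policy minimizes this bound minus `V φ(γ)`: the beam
maximizes the quadratic form of `W'` over the power ball (`IsBeam.weighted_le`), and `γ` is a
minimizer by definition. The competitor comes from an arbitrary feasible policy `y`. In slot `m` one
may send what `y` would send in slot `l` after an independent copy of the history before `l`, with
the true state of slot `m` as current state. The queues at `m` depend only on earlier states, so the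
expected weighted power factors into mean queues times the mean powers of `y` in slot `l`
(`expected_weighted_le`). Averaging over `l` and passing to a subsequence yields limit powers `(q,
s)` that meet the constraints and inherit any lower bound on the utility that `y` attains infinitely
often (`exists_isTarget`). Against this target the `Z` and `Z_AP` terms of the drift drop out, and
only `E[G_i] (g_i - q_i)` remains, for a free comparison vector `g` with `φ g` finite
(`expected_drift_le`). Feasibility: for `g` slightly shifted from `q` towards the peak, `φ g` is
finite, and `E[G_i[m]] ≤ m Ppeak` bounds the drift by `C + ε m`. So the expected Lyapunov function
is `o(L ^ 2)`, the expected queues are `o(L)`, and summing the queue recursions gives the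
constraints. Utility: if `φ q` is finite, `g = q` removes the `G` term, and telescoping bounds the
average of `E[φ(γ)]` below by `φ q - B / V`. Jensen turns this into a bound for `φ` at the averaged
`γ`, which the received powers dominate up to `E[G_i] / L → 0`. The upper bound holds because the
policy is itself feasible. -/

namespace WPT

/-! ### Optimality of the beam for the weighted power -/

section LinearAlgebra

variable {K M N : ℕ}

open scoped InnerProductSpace

/-- In finite dimension the supremum of the Rayleigh quotient is itself an eigenvalue, hence at most
the largest one. -/
theorem _root_.LinearMap.IsSymmetric.re_inner_le_of_isGreatest {E : Type*} [NormedAddCommGroup E]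
    [InnerProductSpace ℂ E] [FiniteDimensional ℂ E] {T : E →ₗ[ℂ] E} (hT : T.IsSymmetric) {t : ℝ}
    (ht : IsGreatest {s : ℝ | Module.End.HasEigenvalue T (s : ℂ)} t) (v : E) :
    RCLike.re ⟪T v, v⟫_ℂ ≤ t * ‖v‖ ^ 2 := by
  by_cases hv : v = 0
  · simp [hv]
  have : Nontrivial E := ⟨v, 0, hv⟩
  have hle := ht.2 (show (⨆ x : {x : E // x ≠ 0}, RCLike.re ⟪T x, (x : E)⟫_ℂ / ‖(x : E)‖ ^ 2)
    ∈ {s : ℝ | Module.End.HasEigenvalue T (s : ℂ)} from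
      hT.hasEigenvalue_iSup_of_finiteDimensional)
  have hbdd : BddAbove (Set.range fun x : {x : E // x ≠ 0} =>
      RCLike.re ⟪T x, (x : E)⟫_ℂ / ‖(x : E)‖ ^ 2) := by
    refine ⟨‖T.toContinuousLinearMap‖, ?_⟩
    rintro _ ⟨x, rfl⟩
    exact (le_abs_self _).trans (T.toContinuousLinearMap.rayleighQuotient_le_norm (x : E))
  have h := (le_ciSup hbdd ⟨v, hv⟩).trans hle
  have hpos : 0 < ‖v‖ ^ 2 := by positivity
  exact (div_le_iff₀ hpos).1 h

theorem re_inner_toEuclideanLin_gram (A : Matrix (Fin M) (Fin N) ℂ) (v : Signal N) :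
    RCLike.re ⟪Matrix.toEuclideanLin (A.conjTranspose * A) v, v⟫_ℂ
      = ‖Matrix.toEuclideanLin A v‖ ^ 2 := by
  have : Matrix.toEuclideanLin (A.conjTranspose * A)
      = Matrix.toEuclideanLin A.conjTranspose ∘ₗ Matrix.toEuclideanLin A :=
    Matrix.toLpLin_mul 2 2 2 _ _
  rw [this, LinearMap.comp_apply, Matrix.toEuclideanLin_conjTranspose_eq_adjoint,
    LinearMap.adjoint_inner_left]
  exact inner_self_eq_norm_sq (𝕜 := ℂ) _

theorem isHermitian_weightedMatrix (η : ℝ) (H : Channel K M N) (G Z : Fin K → ℝ) (a : ℝ) :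
    (weightedMatrix η H G Z a).IsHermitian := by
  unfold weightedMatrix
  rw [Matrix.IsHermitian, Matrix.conjTranspose_sub, Matrix.conjTranspose_sum]
  simp [Matrix.conjTranspose_smul, Matrix.conjTranspose_mul]

theorem re_inner_weightedMatrix (η : ℝ) (H : Channel K M N) (G Z : Fin K → ℝ) (a : ℝ)
    (v : Signal N) :
    RCLike.re ⟪Matrix.toEuclideanLin (weightedMatrix η H G Z a) v, v⟫_ℂ
      = ∑ i, (Z i + G i) * recvPower η (H i) v - a * ‖v‖ ^ 2 := by
  have h1 : Matrix.toEuclideanLin (1 : Matrix (Fin N) (Fin N) ℂ) v = v := by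
    rw [show Matrix.toEuclideanLin (1 : Matrix (Fin N) (Fin N) ℂ) = LinearMap.id from
      Matrix.toLpLin_one 2]; rfl
  unfold weightedMatrix
  rw [map_sub, map_sum, LinearMap.sub_apply, LinearMap.sum_apply, inner_sub_left, sum_inner,
    map_sub, map_sum]
  congr 1
  · refine Finset.sum_congr rfl fun i _ => ?_
    rw [map_smul, LinearMap.smul_apply, inner_smul_left, Complex.conj_ofReal, recvPower,
      ← re_inner_toEuclideanLin_gram]
    simp [mul_assoc]
  · rw [map_smul, LinearMap.smul_apply, h1, inner_smul_left, Complex.conj_ofReal,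
      ← inner_self_eq_norm_sq (𝕜 := ℂ) v]
    simp

theorem IsBeam.norm_sq_le {Ppeak : ℝ} (hP : 0 ≤ Ppeak) {A : Matrix (Fin N) (Fin N) ℂ}
    {x : Signal N} (hx : IsBeam Ppeak A x) : ‖x‖ ^ 2 ≤ Ppeak := by
  obtain ⟨t, -, h0, h1⟩ := hx
  rcases le_or_gt 0 t with ht | ht
  · obtain ⟨u, hu, -, rfl⟩ := h0 ht
    rw [norm_smul, hu, Complex.norm_real, Real.norm_eq_abs, mul_one, sq_abs, Real.sq_sqrt hP]
  · simp [h1 ht, hP]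

/-- The form is at most `t ‖v‖ ^ 2`. For `t ≥ 0` this is at most `t Ppeak`, which the scaled
eigenvector attains; for `t < 0` it is at most `0`, which silence attains. -/
theorem IsBeam.re_inner_le {Ppeak : ℝ} (hP : 0 ≤ Ppeak) {A : Matrix (Fin N) (Fin N) ℂ}
    (hA : A.IsHermitian) {x : Signal N} (hx : IsBeam Ppeak A x) {v : Signal N}
    (hv : ‖v‖ ^ 2 ≤ Ppeak) :
    RCLike.re ⟪Matrix.toEuclideanLin A v, v⟫_ℂ ≤ RCLike.re ⟪Matrix.toEuclideanLin A x, x⟫_ℂ := by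
  obtain ⟨t, ht, h0, h1⟩ := hx
  have hvt := (Matrix.isSymmetric_toEuclideanLin_iff.2 hA).re_inner_le_of_isGreatest ht v
  rcases le_or_gt 0 t with ht0 | ht0
  · obtain ⟨u, hu, hev, rfl⟩ := h0 ht0
    refine hvt.trans ((mul_le_mul_of_nonneg_left hv ht0).trans (le_of_eq ?_))
    rw [map_smul, hev.apply_eq_smul, inner_smul_left, inner_smul_right, inner_smul_left,
      Complex.conj_ofReal, Complex.conj_ofReal, inner_self_eq_norm_sq_to_K, hu]
    simp only [Complex.coe_algebraMap, Complex.ofReal_one, one_pow, mul_one, ← Complex.ofReal_mul]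
    rw [show ∀ r : ℝ, RCLike.re (r : ℂ) = r from Complex.ofReal_re]
    linear_combination -t * Real.mul_self_sqrt hP
  · rw [h1 ht0]
    simp only [map_zero, inner_zero_left]
    exact hvt.trans (mul_nonpos_of_nonpos_of_nonneg ht0.le (by positivity))

theorem IsBeam.weighted_le {Ppeak η : ℝ} (hP : 0 ≤ Ppeak) {H : Channel K M N} {G Z : Fin K → ℝ}
    {a : ℝ} {x : Signal N} (hx : IsBeam Ppeak (weightedMatrix η H G Z a) x) {v : Signal N}
    (hv : ‖v‖ ^ 2 ≤ Ppeak) :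
    ∑ i, (Z i + G i) * recvPower η (H i) v - a * ‖v‖ ^ 2
      ≤ ∑ i, (Z i + G i) * recvPower η (H i) x - a * ‖x‖ ^ 2 := by
  rw [← re_inner_weightedMatrix, ← re_inner_weightedMatrix]
  exact hx.re_inner_le hP (isHermitian_weightedMatrix _ _ _ _ _) hv

theorem recvPower_nonneg {η : ℝ} (hη : 0 ≤ η) (A : Matrix (Fin M) (Fin N) ℂ) (v : Signal N) :
    0 ≤ recvPower η A v := mul_nonneg hη (by positivity)

theorem recvPower_le {η : ℝ} (hη : 0 ≤ η) (A : Matrix (Fin M) (Fin N) ℂ) {v : Signal N} {r : ℝ}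
    (hv : ‖v‖ ^ 2 ≤ r) :
    recvPower η A v ≤ η * (‖(Matrix.toEuclideanLin A).toContinuousLinearMap‖ ^ 2 * r) := by
  refine mul_le_mul_of_nonneg_left ?_ hη
  have h := (Matrix.toEuclideanLin A).toContinuousLinearMap.le_opNorm v
  calc ‖Matrix.toEuclideanLin A v‖ ^ 2
      ≤ (‖(Matrix.toEuclideanLin A).toContinuousLinearMap‖ * ‖v‖) ^ 2 :=
        pow_le_pow_left₀ (norm_nonneg _) h 2
    _ ≤ _ := by rw [mul_pow]; exact mul_le_mul_of_nonneg_left hv (by positivity)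

end LinearAlgebra

/-! ### Measurability of powers and histories -/

section Measurability

variable {K M N : ℕ} {α : Type*} [MeasurableSpace α]

theorem measurable_entry {A : α → Matrix (Fin M) (Fin N) ℂ} (hA : Measurable A) (m : Fin M)
    (n : Fin N) : Measurable fun a => A a m n :=
  (measurable_pi_apply n).comp ((measurable_pi_apply (X := fun _ : Fin M => Fin N → ℂ) m).comp hA)

theorem measurable_recvPower (η : ℝ) {A : α → Matrix (Fin M) (Fin N) ℂ} (hA : Measurable A)
    {v : α → Signal N} (hv : Measurable v) : Measurable fun a => recvPower η (A a) (v a) := by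
  have h : ∀ a, recvPower η (A a) (v a) = η * ∑ m, ‖∑ n, A a m n * v a n‖ ^ 2 := fun a => by
    rw [recvPower, EuclideanSpace.norm_sq_eq]
    rfl
  simp only [h]
  refine measurable_const.mul (Finset.measurable_sum _ fun m _ => ?_)
  refine (Measurable.norm (Finset.measurable_sum _ fun n _ => ?_)).pow_const 2
  exact (measurable_entry hA m n).mul (by fun_prop)

theorem measurable_hist {c : α → ℕ → Channel K M N} {l : ℕ}
    (hc : ∀ j ≤ l, Measurable fun a => c a j) :
    Measurable fun a => hist (c a) l :=
  measurable_pi_lambda _ fun j => hc j (Nat.lt_succ_iff.1 j.2)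

end Measurability

/-! ### Virtual queues: causality, growth bounds and pathwise drift -/

section Queues

variable {K M N : ℕ} (P : Params) (x : Causal K M N (Signal N)) (γ : Causal K M N (Fin K → ℝ))

theorem hist_congr {c c' : ℕ → Channel K M N} {l : ℕ} (h : ∀ j ≤ l, c j = c' j) :
    hist c l = hist c' l := funext fun j => h j (Nat.lt_succ_iff.1 j.2)

theorem queueG_congr {c c' : ℕ → Channel K M N} {l : ℕ} (h : ∀ j < l, c j = c' j) :
    queueG P x γ c l = queueG P x γ c' l := by
  induction l with
  | zero => rfl
  | succ l ih =>
    rw [queueG, queueG, ih fun j hj => h j (hj.trans l.lt_succ_self), h l l.lt_succ_self,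
      hist_congr fun j hj => h j (Nat.lt_succ_of_le hj)]

theorem queueZ_congr {c c' : ℕ → Channel K M N} {l : ℕ} (h : ∀ j < l, c j = c' j) :
    queueZ P x c l = queueZ P x c' l := by
  induction l with
  | zero => rfl
  | succ l ih =>
    rw [queueZ, queueZ, ih fun j hj => h j (hj.trans l.lt_succ_self), h l l.lt_succ_self,
      hist_congr fun j hj => h j (Nat.lt_succ_of_le hj)]

theorem queueAP_congr {c c' : ℕ → Channel K M N} {l : ℕ} (h : ∀ j < l, c j = c' j) :
    queueAP P x c l = queueAP P x c' l := by
  induction l with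
  | zero => rfl
  | succ l ih =>
    rw [queueAP, queueAP, ih fun j hj => h j (hj.trans l.lt_succ_self),
      hist_congr fun j hj => h j (Nat.lt_succ_of_le hj)]

variable {P x γ} {α : Type*} [MeasurableSpace α]

theorem measurable_queueG (hx : ∀ l, Measurable (x l)) (hγ : ∀ l, Measurable (γ l))
    {c : α → ℕ → Channel K M N} (hc : ∀ j, Measurable fun a => c a j) (l : ℕ) (i : Fin K) :
    Measurable fun a => queueG P x γ (c a) l i := by
  induction l with
  | zero => exact measurable_const
  | succ l ih =>
    have hh := measurable_hist (l := l) fun j _ => hc j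
    exact ((ih.add ((measurable_pi_apply i).comp ((hγ l).comp hh))).sub
      (measurable_recvPower _ ((measurable_pi_apply i).comp (hc l)) ((hx l).comp hh))).max
      measurable_const

theorem measurable_queueZ (hx : ∀ l, Measurable (x l))
    {c : α → ℕ → Channel K M N} (hc : ∀ j, Measurable fun a => c a j) (l : ℕ) (i : Fin K) :
    Measurable fun a => queueZ P x (c a) l i := by
  induction l with
  | zero => exact measurable_const
  | succ l ih =>
    have hh := measurable_hist (l := l) fun j _ => hc j
    exact ((ih.add measurable_const).sub
      (measurable_recvPower _ ((measurable_pi_apply i).comp (hc l)) ((hx l).comp hh))).max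
      measurable_const

theorem measurable_queueAP (hx : ∀ l, Measurable (x l))
    {c : α → ℕ → Channel K M N} (hc : ∀ j, Measurable fun a => c a j) (l : ℕ) :
    Measurable fun a => queueAP P x (c a) l := by
  induction l with
  | zero => exact measurable_const
  | succ l ih =>
    have hh := measurable_hist (l := l) fun j _ => hc j
    exact ((ih.add (((hx l).comp hh).norm.pow_const 2)).sub measurable_const).max
      measurable_const

theorem queueG_nonneg (c : ℕ → Channel K M N) (l : ℕ) (i : Fin K) : 0 ≤ queueG P x γ c l i := by
  cases l with
  | zero => exact le_rfl
  | succ l => exact le_max_right _ _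

theorem queueZ_nonneg (c : ℕ → Channel K M N) (l : ℕ) (i : Fin K) : 0 ≤ queueZ P x c l i := by
  cases l with
  | zero => exact le_rfl
  | succ l => exact le_max_right _ _

theorem queueAP_nonneg (c : ℕ → Channel K M N) (l : ℕ) : 0 ≤ queueAP P x c l := by
  cases l with
  | zero => exact le_rfl
  | succ l => exact le_max_right _ _

theorem queueG_le (hη : 0 ≤ P.η) (hP : 0 ≤ P.Ppeak) {c : ℕ → Channel K M N} {i : Fin K}
    (hγ : ∀ l, γ l (hist c l) i ≤ P.Ppeak) (l : ℕ) : queueG P x γ c l i ≤ l * P.Ppeak := by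
  induction l with
  | zero => simp [queueG]
  | succ l ih =>
    have h1 := recvPower_nonneg hη (c l i) (x l (hist c l))
    have h2 := hγ l
    refine max_le ?_ (by positivity)
    push_cast
    linarith

theorem queueZ_le (hη : 0 ≤ P.η) (hP : 0 ≤ P.Pmin) (c : ℕ → Channel K M N) (i : Fin K)
    (l : ℕ) : queueZ P x c l i ≤ l * P.Pmin := by
  induction l with
  | zero => simp [queueZ]
  | succ l ih =>
    have h1 := recvPower_nonneg hη (c l i) (x l (hist c l))
    refine max_le ?_ (by positivity)
    push_cast
    linarith

theorem queueAP_le (hP : 0 ≤ P.Ppeak) (hA : 0 ≤ P.Pavg) {c : ℕ → Channel K M N}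
    (hx : ∀ l, ‖x l (hist c l)‖ ^ 2 ≤ P.Ppeak) (l : ℕ) : queueAP P x c l ≤ l * P.Ppeak := by
  induction l with
  | zero => simp [queueAP]
  | succ l ih =>
    have h2 := hx l
    refine max_le ?_ (by positivity)
    push_cast
    linarith

/-- Covers `Pavg > Ppeak`, where `|‖x‖ ^ 2 - Pavg| ≤ Ppeak` may fail and the quadratic drift
estimate is unavailable. -/
theorem queueAP_eq_zero (hA : P.Ppeak ≤ P.Pavg) {c : ℕ → Channel K M N}
    (hx : ∀ l, ‖x l (hist c l)‖ ^ 2 ≤ P.Ppeak) (l : ℕ) : queueAP P x c l = 0 := by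
  induction l with
  | zero => rfl
  | succ l ih =>
    have h2 := hx l
    rw [queueAP, ih, max_eq_right]
    linarith

/-- The quadratic Lyapunov function `½ (∑ i, (G_i ^ 2 + Z_i ^ 2) + Z_AP ^ 2)`. -/
noncomputable def lyapunov (P : Params) (x : Causal K M N (Signal N))
    (γ : Causal K M N (Fin K → ℝ)) (c : ℕ → Channel K M N) (l : ℕ) : ℝ :=
  (∑ i, (queueG P x γ c l i ^ 2 + queueZ P x c l i ^ 2) + queueAP P x c l ^ 2) / 2

theorem sq_max_add_sub_le {g a b p : ℝ} (ha : 0 ≤ a) (hap : a ≤ p) (hb : 0 ≤ b)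
    (hbp : b ≤ p) : max (g + a - b) 0 ^ 2 ≤ g ^ 2 + 2 * (g * (a - b)) + p ^ 2 := by
  have h : (a - b) ^ 2 ≤ p ^ 2 := sq_le_sq' (by linarith) (by linarith)
  rcases max_cases (g + a - b) 0 with ⟨h1, -⟩ | ⟨h1, -⟩ <;> rw [h1] <;>
    nlinarith [sq_nonneg (g + (a - b))]

/-- Each queue has arrival and service in `[0, Ppeak]`, so its squared increment costs at most
`Ppeak ^ 2`. The bound on `Pmin` is requested only in the presence of a receiver, since it will be
deduced from the received powers of a feasible policy. -/
theorem lyapunov_succ_le (hη : 0 ≤ P.η) (hmin : 0 ≤ P.Pmin)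
    (hminP : Fin K → P.Pmin ≤ P.Ppeak) (havg : 0 ≤ P.Pavg) {c : ℕ → Channel K M N}
    (hx : ∀ l, ‖x l (hist c l)‖ ^ 2 ≤ P.Ppeak)
    (hγ : ∀ l i, 0 ≤ γ l (hist c l) i ∧ γ l (hist c l) i ≤ P.Ppeak) (l : ℕ)
    (hQ : ∀ i, recvPower P.η (c l i) (x l (hist c l)) ≤ P.Ppeak) :
    lyapunov P x γ c (l + 1) ≤ lyapunov P x γ c l + (2 * K + 1) / 2 * P.Ppeak ^ 2
      + ∑ i, (queueG P x γ c l i * (γ l (hist c l) i - recvPower P.η (c l i) (x l (hist c l)))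
        + queueZ P x c l i * (P.Pmin - recvPower P.η (c l i) (x l (hist c l))))
      + queueAP P x c l * (‖x l (hist c l)‖ ^ 2 - P.Pavg) := by
  have hG : ∀ i, queueG P x γ c (l + 1) i ^ 2 + queueZ P x c (l + 1) i ^ 2 ≤
      (queueG P x γ c l i ^ 2 + queueZ P x c l i ^ 2) + 2 * P.Ppeak ^ 2
      + 2 * (queueG P x γ c l i * (γ l (hist c l) i - recvPower P.η (c l i) (x l (hist c l)))
        + queueZ P x c l i * (P.Pmin - recvPower P.η (c l i) (x l (hist c l)))) := fun i => by
    have hq := recvPower_nonneg hη (c l i) (x l (hist c l))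
    have h1 := sq_max_add_sub_le (g := queueG P x γ c l i) (hγ l i).1 (hγ l i).2 hq (hQ i)
    have h2 := sq_max_add_sub_le (g := queueZ P x c l i) hmin (hminP i) hq (hQ i)
    rw [queueG, queueZ]
    linarith
  have hA : queueAP P x c (l + 1) ^ 2 ≤ queueAP P x c l ^ 2
      + 2 * (queueAP P x c l * (‖x l (hist c l)‖ ^ 2 - P.Pavg)) + P.Ppeak ^ 2 := by
    rcases le_total P.Pavg P.Ppeak with h | h
    · exact sq_max_add_sub_le (by positivity) (hx l) havg h
    · rw [queueAP_eq_zero h hx, queueAP_eq_zero h hx]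
      have := sq_nonneg P.Ppeak
      linarith
  have hS := Finset.sum_le_sum fun i (_ : i ∈ Finset.univ) => hG i
  unfold lyapunov
  simp only [Finset.sum_add_distrib, ← Finset.mul_sum, Finset.sum_const, Finset.card_univ,
    Fintype.card_fin, nsmul_eq_mul] at hS ⊢
  linarith

end Queues

end WPT

/-! ### Independence of past and present channel states -/

namespace WPT

set_option linter.unusedSectionVars false

variable {K M N : ℕ} {Ω : Type*} [MeasurableSpace Ω] {μ : Measure Ω}

/-- The standing assumptions on parameters and channel states. -/
structure IsModel (P : Params) (μ : Measure Ω) (H : ℕ → Ω → Channel K M N) : Prop where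
  eta_nonneg : 0 ≤ P.η
  peak_pos : 0 < P.Ppeak
  min_nonneg : 0 ≤ P.Pmin
  V_pos : 0 < P.V
  measurable : ∀ l, Measurable (H l)
  indep : iIndepFun H μ
  ident : ∀ l, IdentDistrib (H l) (H 0) μ μ
  passive : ∀ l, ∀ᵐ ω ∂μ, ∀ (i : Fin K) (v : Signal N), recvPower P.η (H l ω i) v ≤ ‖v‖ ^ 2

/-- The channel sequence of the outcome `ω`. -/
abbrev path (H : ℕ → Ω → Channel K M N) (ω : Ω) : ℕ → Channel K M N := fun j => H j ω

/-- The channel sequence of the outcome `ω` before slot `l`, extended by zero. -/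
def past (H : ℕ → Ω → Channel K M N) (l : ℕ) (ω : Ω) : ℕ → Channel K M N :=
  fun j => if j < l then H j ω else fun _ => 0

theorem measurable_past {H : ℕ → Ω → Channel K M N} (hH : ∀ l, Measurable (H l)) (l : ℕ) :
    Measurable (past H l) := by
  refine measurable_pi_lambda _ fun j => ?_
  unfold past
  split_ifs
  · exact hH j
  · exact measurable_const

theorem indepFun_past {H : ℕ → Ω → Channel K M N} (hH : ∀ l, Measurable (H l))
    (hind : iIndepFun H μ) (l : ℕ) : IndepFun (past H l) (H l) μ := by
  have h := hind.indepFun_finset (Finset.range l) {l} (by simp) hH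
  let e : ((j : Finset.range l) → Channel K M N) → ℕ → Channel K M N :=
    fun t j => if hj : j ∈ Finset.range l then t ⟨j, hj⟩ else fun _ => 0
  have he : Measurable e := by
    refine measurable_pi_lambda _ fun j => ?_
    by_cases hj : j ∈ Finset.range l
    · simpa only [e, hj, dite_true] using measurable_pi_apply (⟨j, hj⟩ : Finset.range l)
    · simpa only [e, hj, dite_false] using measurable_const
  have h2 := h.comp he
    (measurable_pi_apply (X := fun _ : ({l} : Finset ℕ) => Channel K M N) ⟨l, by simp⟩)
  have h3 : past H l = e ∘ fun ω j => H (↑j) ω := by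
    funext ω j
    simp [e, past]
  rw [h3]
  exact h2

/-- Zero padding makes `past` a full channel sequence, on which a functional of the first `l` states
takes the same value as on the true path. -/
theorem indepFun_of_past {β : Type*} [MeasurableSpace β] {H : ℕ → Ω → Channel K M N}
    (hH : ∀ l, Measurable (H l)) (hind : iIndepFun H μ) {l : ℕ} {F : (ℕ → Channel K M N) → β}
    (hF : Measurable F) (hcongr : ∀ c c', (∀ j < l, c j = c' j) → F c = F c') :
    IndepFun (fun ω => F (path H ω)) (H l) μ := by
  have h := (indepFun_past hH hind l).comp hF measurable_id
  have h2 : (fun ω => F (path H ω)) = F ∘ past H l :=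
    funext fun ω => hcongr _ _ fun j hj => by simp [past, hj]
  rw [h2]
  exact h

/-- Independence makes the joint law a product, so Fubini applies. -/
theorem integral_eq_integral_integral_of_indepFun [IsProbabilityMeasure μ] {β β' : Type*}
    [MeasurableSpace β] [MeasurableSpace β'] {X : Ω → β} {Y : Ω → β'} (hX : Measurable X)
    (hY : Measurable Y) (h : IndepFun X Y μ) {F : β × β' → ℝ} (hF : Measurable F)
    (hint : Integrable (fun ω => F (X ω, Y ω)) μ) :
    ∫ ω, F (X ω, Y ω) ∂μ = ∫ ω', ∫ ω, F (X ω, Y ω') ∂μ ∂μ := by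
  have hmap := (indepFun_iff_map_prod_eq_prod_map_map hX.aemeasurable hY.aemeasurable).1 h
  have hpX := Measure.isProbabilityMeasure_map (μ := μ) hX.aemeasurable
  have hpY := Measure.isProbabilityMeasure_map (μ := μ) hY.aemeasurable
  have h1 : ∫ ω, F (X ω, Y ω) ∂μ = ∫ z, F z ∂((μ.map X).prod (μ.map Y)) := by
    rw [← hmap, integral_map (hX.prodMk hY).aemeasurable hF.aestronglyMeasurable]
  have hi : Integrable F ((μ.map X).prod (μ.map Y)) := by
    rw [← hmap]
    exact (integrable_map_measure hF.aestronglyMeasurable (hX.prodMk hY).aemeasurable).2 hint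
  rw [h1, integral_prod_symm _ hi, integral_map hY.aemeasurable]
  · refine integral_congr_ae (Eventually.of_forall fun ω' => ?_)
    exact integral_map hX.aemeasurable (hF.comp measurable_prodMk_right).aestronglyMeasurable
  · exact (hF.stronglyMeasurable.integral_prod_left' (μ := μ.map X)).aestronglyMeasurable

theorem integrable_of_abs_le [IsProbabilityMeasure μ] {f : Ω → ℝ} (hf : Measurable f) {C : ℝ}
    (h : ∀ᵐ ω ∂μ, |f ω| ≤ C) : Integrable f μ :=
  Integrable.of_bound hf.aestronglyMeasurable C h

theorem integral_mem_Icc [IsProbabilityMeasure μ] {f : Ω → ℝ} {C : ℝ}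
    (h0 : ∀ᵐ ω ∂μ, 0 ≤ f ω) (h : ∀ᵐ ω ∂μ, f ω ≤ C) : ∫ ω, f ω ∂μ ∈ Set.Icc 0 C := by
  refine ⟨integral_nonneg_of_ae h0, ?_⟩
  have hC : 0 ≤ C := by
    obtain ⟨ω, h1, h2⟩ := (h0.and h).exists
    exact h1.trans h2
  by_cases hi : Integrable f μ
  · simpa using integral_mono_ae hi (integrable_const C) h
  -- A non-integrable function has integral `0`, which also obeys the bound; thus no measurability
  -- is needed.
  · rwa [integral_undef hi]

/-! ### Comparison with a replayed competitor -/

section Dominance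

variable [IsProbabilityMeasure μ] {P : Params} {H : ℕ → Ω → Channel K M N}
  {x y : Causal K M N (Signal N)} {γ : Causal K M N (Fin K → ℝ)} {φ : (Fin K → ℝ) → EReal}

/-- The signal of slot `l` of the policy `y` when the channel state of that slot is replaced. -/
def replaySignal (y : Causal K M N (Signal N)) (l : ℕ) (z : (ℕ → Channel K M N) × Channel K M N) :
    Signal N := y l (hist (Function.update z.1 l z.2) l)

theorem measurable_replaySignal (hy : ∀ l, Measurable (y l)) (l : ℕ) :
    Measurable (replaySignal y l) := by
  refine (hy l).comp (measurable_hist fun j _ => ?_)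
  by_cases hj : j = l
  · subst hj
    simpa using measurable_snd
  · simp only [Function.update_of_ne hj]
    exact (measurable_pi_apply j).comp measurable_fst

theorem replaySignal_past (y : Causal K M N (Signal N)) (l : ℕ) (ω : Ω) :
    replaySignal y l (past H l ω, H l ω) = y l (hist (path H ω) l) := by
  unfold replaySignal
  congr 1
  refine hist_congr fun j hj => ?_
  rcases hj.eq_or_lt with rfl | hj
  · simp
  · simp [Function.update_of_ne hj.ne, past, hj]

theorem IsModel.measurable_signal (hM : IsModel P μ H) (hy : ∀ l, Measurable (y l)) (l : ℕ) :
    Measurable fun ω => y l (hist (path H ω) l) :=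
  (hy l).comp (measurable_hist fun j _ => hM.measurable j)

theorem IsModel.measurable_recv (hM : IsModel P μ H) (hy : ∀ l, Measurable (y l)) (l : ℕ)
    (i : Fin K) : Measurable fun ω => recvPower P.η (H l ω i) (y l (hist (path H ω) l)) :=
  measurable_recvPower _ ((measurable_pi_apply i).comp (hM.measurable l))
    (hM.measurable_signal hy l)

theorem IsModel.recv_le (hM : IsModel P μ H) (hy : ∀ l h, ‖y l h‖ ^ 2 ≤ P.Ppeak) (l : ℕ) :
    ∀ᵐ ω ∂μ, ∀ i, recvPower P.η (H l ω i) (y l (hist (path H ω) l)) ≤ P.Ppeak := by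
  filter_upwards [hM.passive l] with ω h i using (h i _).trans (hy _ _)

theorem IsModel.integrable_recv (hM : IsModel P μ H) (hm : ∀ l, Measurable (y l))
    (hy : ∀ l h, ‖y l h‖ ^ 2 ≤ P.Ppeak) (l : ℕ) (i : Fin K) :
    Integrable (fun ω => recvPower P.η (H l ω i) (y l (hist (path H ω) l))) μ := by
  refine integrable_of_abs_le (hM.measurable_recv hm l i) (C := P.Ppeak) ?_
  filter_upwards [hM.recv_le hy l] with ω h
  rw [abs_of_nonneg (recvPower_nonneg hM.eta_nonneg _ _)]
  exact h i

theorem IsModel.integrable_sent (hM : IsModel P μ H) (hm : ∀ l, Measurable (y l))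
    (hy : ∀ l h, ‖y l h‖ ^ 2 ≤ P.Ppeak) (l : ℕ) :
    Integrable (fun ω => ‖y l (hist (path H ω) l)‖ ^ 2) μ := by
  refine integrable_of_abs_le ((hM.measurable_signal hm l).norm.pow_const 2) (C := P.Ppeak) ?_
  refine Eventually.of_forall fun ω => ?_
  rw [abs_of_nonneg (by positivity)]
  exact hy _ _

theorem IsModel.measurable_integral_past (hM : IsModel P μ H)
    {F : (ℕ → Channel K M N) × Channel K M N → ℝ} (hF : Measurable F) (l : ℕ) :
    Measurable fun h => ∫ ω, F (past H l ω, h) ∂μ :=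
  (StronglyMeasurable.integral_prod_left' (μ := μ) (f := fun z : Ω × Channel K M N =>
    F (past H l z.1, z.2)) (hF.comp (((measurable_past hM.measurable l).comp
      measurable_fst).prodMk measurable_snd)).stronglyMeasurable).measurable

/-- The expectation of a function of the past and of the current channel state is unchanged when
the current state is taken from another slot of an independent copy. -/
theorem IsModel.integral_replay (hM : IsModel P μ H) {l : ℕ}
    {F : (ℕ → Channel K M N) × Channel K M N → ℝ} (hF : Measurable F)
    (hint : Integrable (fun ω => F (past H l ω, H l ω)) μ) (m : ℕ) :
    ∫ ω', ∫ ω, F (past H l ω, H m ω') ∂μ ∂μ = ∫ ω, F (past H l ω, H l ω) ∂μ := by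
  rw [integral_eq_integral_integral_of_indepFun (measurable_past hM.measurable l)
    (hM.measurable l) (indepFun_past hM.measurable hM.indep l) hF hint]
  have hg := hM.measurable_integral_past hF l
  exact (((hM.ident m).trans (hM.ident l).symm).comp hg).integral_eq

/-- The weight depends on slots before `m` and the inner integral on slot `m` alone, so the
expectation of the product factors; equality in law of the states then replaces slot `m` by slot
`l`. -/
theorem IsModel.integral_mul_replay (hM : IsModel P μ H) {l : ℕ}
    {F : (ℕ → Channel K M N) × Channel K M N → ℝ} (hF : Measurable F)
    (hint : Integrable (fun ω => F (past H l ω, H l ω)) μ) {m : ℕ}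
    {W : (ℕ → Channel K M N) → ℝ} (hW : Measurable W)
    (hcongr : ∀ c c', (∀ j < m, c j = c' j) → W c = W c') :
    ∫ ω', W (path H ω') * ∫ ω, F (past H l ω, H m ω') ∂μ ∂μ
      = (∫ ω, W (path H ω) ∂μ) * ∫ ω, F (past H l ω, H l ω) ∂μ := by
  have hg := hM.measurable_integral_past hF l
  have hind := (indepFun_of_past hM.measurable hM.indep hW hcongr).comp measurable_id hg
  rw [← hM.integral_replay hF hint m]
  exact hind.integral_fun_mul_eq_mul_integral
    (hW.comp (measurable_pi_lambda _ hM.measurable)).aestronglyMeasurable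
    (hg.comp (hM.measurable m)).aestronglyMeasurable

theorem IsModel.integrable_mul_replay (hM : IsModel P μ H) {l m : ℕ}
    {F : (ℕ → Channel K M N) × Channel K M N → ℝ} (hF : Measurable F) (hF0 : ∀ z, 0 ≤ F z)
    {C D : ℝ} (hFC : ∀ᵐ ω' ∂μ, ∀ ω, F (past H l ω, H m ω') ≤ C)
    {W : (ℕ → Channel K M N) → ℝ} (hW : Measurable W) (hW0 : ∀ c, 0 ≤ W c)
    (hWD : ∀ c, W c ≤ D) :
    Integrable (fun ω' => W (path H ω') * ∫ ω, F (past H l ω, H m ω') ∂μ) μ := by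
  have hg := hM.measurable_integral_past hF l
  refine integrable_of_abs_le ((hW.comp (measurable_pi_lambda _ hM.measurable)).mul
    (hg.comp (hM.measurable m))) (C := D * C) ?_
  filter_upwards [hFC] with ω' h
  have h1 := integral_mem_Icc (μ := μ) (f := fun ω => F (past H l ω, H m ω'))
    (Eventually.of_forall fun ω => hF0 _) (Eventually.of_forall h)
  change |W (path H ω') * ∫ ω, F (past H l ω, H m ω') ∂μ| ≤ D * C
  rw [abs_of_nonneg (mul_nonneg (hW0 _) h1.1)]
  exact mul_le_mul (hWD _) h1.2 h1.1 ((hW0 _).trans (hWD (path H ω')))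

theorem IsQFWPT.peakPower (hP : 0 ≤ P.Ppeak) (hx : IsQFWPT P φ x γ) (l : ℕ)
    (h : Fin (l + 1) → Channel K M N) : ‖x l h‖ ^ 2 ≤ P.Ppeak := by
  -- The peak constraint concerns every finite history, so the history is extended to a channel
  -- sequence; the values after slot `l` are irrelevant.
  have hh : hist (fun j => if hj : j < l + 1 then h ⟨j, hj⟩ else h 0) l = h := by
    funext j
    simp [hist, j.2]
  rw [← hh]
  exact (hx.beam _ l).norm_sq_le hP

/-- With the path `c` frozen, the replayed signal is random only through the independent past; the
beam beats each of its values, hence their mean. -/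
theorem IsQFWPT.weights_replay_le (hM : IsModel P μ H) (hx : IsQFWPT P φ x γ)
    (hym : ∀ l, Measurable (y l)) (hy : ∀ l h, ‖y l h‖ ^ 2 ≤ P.Ppeak)
    (c : ℕ → Channel K M N) (l m : ℕ) :
    ∑ i, (queueZ P x c m i + queueG P x γ c m i)
        * ∫ ω, recvPower P.η (c m i) (replaySignal y l (past H l ω, c m)) ∂μ
      - queueAP P x c m * ∫ ω, ‖replaySignal y l (past H l ω, c m)‖ ^ 2 ∂μ
    ≤ ∑ i, (queueZ P x c m i + queueG P x γ c m i) * recvPower P.η (c m i) (x m (hist c m))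
      - queueAP P x c m * ‖x m (hist c m)‖ ^ 2 := by
  have hv : Measurable fun ω => replaySignal y l (past H l ω, c m) :=
    (measurable_replaySignal hym l).comp ((measurable_past hM.measurable l).prodMk
      measurable_const)
  have hvP : ∀ ω, ‖replaySignal y l (past H l ω, c m)‖ ^ 2 ≤ P.Ppeak := fun ω => hy _ _
  have hi1 : ∀ i, Integrable
      (fun ω => recvPower P.η (c m i) (replaySignal y l (past H l ω, c m))) μ := fun i => by
    refine integrable_of_abs_le (measurable_recvPower _ measurable_const hv)
      -- Passivity holds only almost surely and may fail for this fixed `c`, so integrability rests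
      -- on the operator norm instead.
      (C := P.η * (‖(Matrix.toEuclideanLin (c m i)).toContinuousLinearMap‖ ^ 2 * P.Ppeak))
      (Eventually.of_forall fun ω => ?_)
    rw [abs_of_nonneg (recvPower_nonneg hM.eta_nonneg _ _)]
    exact recvPower_le hM.eta_nonneg _ (hvP ω)
  have hi2 : Integrable (fun ω => ‖replaySignal y l (past H l ω, c m)‖ ^ 2) μ := by
    refine integrable_of_abs_le (hv.norm.pow_const 2) (C := P.Ppeak)
      (Eventually.of_forall fun ω => ?_)
    rw [abs_of_nonneg (by positivity)]
    exact hvP ω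
  have hi3 := integrable_finsetSum Finset.univ fun i _ =>
    (hi1 i).const_mul (queueZ P x c m i + queueG P x γ c m i)
  have h := integral_mono (hi3.sub (hi2.const_mul (queueAP P x c m))) (integrable_const _)
    fun ω => (hx.beam c m).weighted_le hM.peak_pos.le (hvP ω)
  simp only [Pi.sub_apply] at h
  rw [integral_sub hi3 (hi2.const_mul _), integral_finsetSum _ fun i _ => (hi1 i).const_mul _,
    integral_const_mul, integral_const, probReal_univ, one_smul] at h
  simpa only [integral_const_mul] using h

theorem IsQFWPT.queueG_le (hM : IsModel P μ H) (hx : IsQFWPT P φ x γ) (c : ℕ → Channel K M N)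
    (l : ℕ) (i : Fin K) : queueG P x γ c l i ≤ l * P.Ppeak :=
  WPT.queueG_le hM.eta_nonneg hM.peak_pos.le (fun l => ((hx.aux c l).1 i).2) l

theorem IsQFWPT.queueAP_le (hM : IsModel P μ H) (hx : IsQFWPT P φ x γ) (havg : 0 ≤ P.Pavg)
    (c : ℕ → Channel K M N) (l : ℕ) : queueAP P x c l ≤ l * P.Ppeak :=
  WPT.queueAP_le hM.peak_pos.le havg (fun l => hx.peakPower hM.peak_pos.le l _) l

theorem measurable_queueG_path (hM : IsModel P μ H) (hx : IsQFWPT P φ x γ) (l : ℕ) (i : Fin K) :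
    Measurable fun ω => queueG P x γ (path H ω) l i :=
  measurable_queueG hx.measurable_signal hx.measurable_aux hM.measurable l i

theorem measurable_queueZ_path (hM : IsModel P μ H) (hx : IsQFWPT P φ x γ) (l : ℕ) (i : Fin K) :
    Measurable fun ω => queueZ P x (path H ω) l i :=
  measurable_queueZ hx.measurable_signal hM.measurable l i

theorem measurable_queueAP_path (hM : IsModel P μ H) (hx : IsQFWPT P φ x γ) (l : ℕ) :
    Measurable fun ω => queueAP P x (path H ω) l :=
  measurable_queueAP hx.measurable_signal hM.measurable l

theorem integrable_weighted (hM : IsModel P μ H) (hx : IsQFWPT P φ x γ) (havg : 0 ≤ P.Pavg)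
    (m : ℕ) :
    Integrable (fun ω => ∑ i, (queueZ P x (path H ω) m i + queueG P x γ (path H ω) m i)
      * recvPower P.η (H m ω i) (x m (hist (path H ω) m))
      - queueAP P x (path H ω) m * ‖x m (hist (path H ω) m)‖ ^ 2) μ := by
  have hp := hx.peakPower hM.peak_pos.le
  refine (integrable_finsetSum _ fun i _ => ?_).sub ?_
  · refine (hM.integrable_recv hx.measurable_signal hp m i).bdd_mul
      (c := m * P.Pmin + m * P.Ppeak)
      ((measurable_queueZ_path hM hx m i).add
        (measurable_queueG_path hM hx m i)).aestronglyMeasurable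
      (Eventually.of_forall fun ω => ?_)
    rw [Real.norm_eq_abs,
      abs_of_nonneg (add_nonneg (queueZ_nonneg _ _ _) (queueG_nonneg _ _ _))]
    exact add_le_add (queueZ_le hM.eta_nonneg hM.min_nonneg _ _ _) (hx.queueG_le hM _ _ _)
  · refine (hM.integrable_sent hx.measurable_signal hp m).bdd_mul (c := m * P.Ppeak)
      (measurable_queueAP_path hM hx m).aestronglyMeasurable (Eventually.of_forall fun ω => ?_)
    rw [Real.norm_eq_abs, abs_of_nonneg (queueAP_nonneg _ _)]
    exact hx.queueAP_le hM havg _ _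

/-- In every slot `m` the beamformer achieves, in expectation, a weighted received power at least
that of any slot `l` of any other policy `y`, for the weights of slot `m`. -/
theorem expected_weighted_le (hM : IsModel P μ H) (hx : IsQFWPT P φ x γ) (havg : 0 ≤ P.Pavg)
    (hym : ∀ l, Measurable (y l)) (hy : ∀ l h, ‖y l h‖ ^ 2 ≤ P.Ppeak) (l m : ℕ) :
    ∑ i, (∫ ω, (queueZ P x (path H ω) m i + queueG P x γ (path H ω) m i) ∂μ)
        * ∫ ω, recvPower P.η (H l ω i) (y l (hist (path H ω) l)) ∂μ
      - (∫ ω, queueAP P x (path H ω) m ∂μ) * ∫ ω, ‖y l (hist (path H ω) l)‖ ^ 2 ∂μ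
    ≤ ∫ ω, (∑ i, (queueZ P x (path H ω) m i + queueG P x γ (path H ω) m i)
        * recvPower P.η (H m ω i) (x m (hist (path H ω) m))
      - queueAP P x (path H ω) m * ‖x m (hist (path H ω) m)‖ ^ 2) ∂μ := by
  have hmeas_id : ∀ j, Measurable fun c : ℕ → Channel K M N => c j := measurable_pi_apply
  have hW : ∀ i, Measurable fun c : ℕ → Channel K M N =>
      queueZ P x c m i + queueG P x γ c m i := fun i =>
    (measurable_queueZ hx.measurable_signal hmeas_id m i).add
      (measurable_queueG hx.measurable_signal hx.measurable_aux hmeas_id m i)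
  have hA : Measurable fun c : ℕ → Channel K M N => queueAP P x c m :=
    measurable_queueAP hx.measurable_signal hmeas_id m
  let F : Fin K → (ℕ → Channel K M N) × Channel K M N → ℝ :=
    fun i z => recvPower P.η (z.2 i) (replaySignal y l z)
  let S : (ℕ → Channel K M N) × Channel K M N → ℝ := fun z => ‖replaySignal y l z‖ ^ 2
  have hF : ∀ i, Measurable (F i) := fun i => measurable_recvPower _
    ((measurable_pi_apply i).comp measurable_snd) (measurable_replaySignal hym l)
  have hS : Measurable S := (measurable_replaySignal hym l).norm.pow_const 2
  have hFeq : ∀ i ω, F i (past H l ω, H l ω)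
      = recvPower P.η (H l ω i) (y l (hist (path H ω) l)) := fun i ω => by
    simp only [F, replaySignal_past]
  have hSeq : ∀ ω, S (past H l ω, H l ω) = ‖y l (hist (path H ω) l)‖ ^ 2 := fun ω => by
    simp only [S, replaySignal_past]
  have hFi : ∀ i, Integrable (fun ω => F i (past H l ω, H l ω)) μ := fun i => by
    simpa only [hFeq] using hM.integrable_recv hym hy l i
  have hSi : Integrable (fun ω => S (past H l ω, H l ω)) μ := by
    simpa only [hSeq] using hM.integrable_sent hym hy l
  have hI1 : ∀ i, Integrable (fun ω' => (queueZ P x (path H ω') m i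
      + queueG P x γ (path H ω') m i) * ∫ ω, F i (past H l ω, H m ω') ∂μ) μ := fun i => by
    refine hM.integrable_mul_replay (W := fun c => queueZ P x c m i + queueG P x γ c m i)
      (hF i) (fun z => recvPower_nonneg hM.eta_nonneg _ _) (C := P.Ppeak) ?_ (hW i)
      (fun c => add_nonneg (queueZ_nonneg _ _ _) (queueG_nonneg _ _ _))
      (fun c => add_le_add (queueZ_le hM.eta_nonneg hM.min_nonneg _ _ _) (hx.queueG_le hM _ _ _))
    filter_upwards [hM.passive m] with ω' h ω using (h i _).trans (hy _ _)
  have hI2 : Integrable (fun ω' => queueAP P x (path H ω') m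
      * ∫ ω, S (past H l ω, H m ω') ∂μ) μ :=
    hM.integrable_mul_replay (W := fun c => queueAP P x c m)
      hS (fun z => by positivity) (C := P.Ppeak) (Eventually.of_forall fun ω' ω => hy _ _) hA
      (fun c => queueAP_nonneg _ _) (fun c => hx.queueAP_le hM havg _ _)
  have hE1 : ∀ i, ∫ ω', (queueZ P x (path H ω') m i + queueG P x γ (path H ω') m i)
      * ∫ ω, F i (past H l ω, H m ω') ∂μ ∂μ
      = (∫ ω, (queueZ P x (path H ω) m i + queueG P x γ (path H ω) m i) ∂μ)
        * ∫ ω, F i (past H l ω, H l ω) ∂μ := fun i =>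
    hM.integral_mul_replay (W := fun c => queueZ P x c m i + queueG P x γ c m i) (hF i) (hFi i)
      (hW i) fun c c' h => by simp only [queueZ_congr P x h, queueG_congr P x γ h]
  have hE2 : ∫ ω', queueAP P x (path H ω') m * ∫ ω, S (past H l ω, H m ω') ∂μ ∂μ
      = (∫ ω, queueAP P x (path H ω) m ∂μ) * ∫ ω, S (past H l ω, H l ω) ∂μ :=
    hM.integral_mul_replay (W := fun c => queueAP P x c m) hS hSi hA
      fun c c' h => queueAP_congr P x h
  simp only [← hFeq, ← hSeq, ← hE1, ← hE2]
  rw [← integral_finsetSum _ fun i _ => hI1 i,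
    ← integral_sub (integrable_finsetSum _ fun i _ => hI1 i) hI2]
  exact integral_mono ((integrable_finsetSum _ fun i _ => hI1 i).sub hI2)
    (integrable_weighted hM hx havg m) fun ω => hx.weights_replay_le hM hym hy (path H ω) l m

end Dominance

end WPT

namespace WPT

/-! ### Averages and limits of real sequences -/

section RealSequences

/-- Summing the increments gives at most `T 0 + C L + ε L ^ 2`, and `ε` is arbitrary. -/
theorem tendsto_div_sq_of_forall_drift_le {T : ℕ → ℝ} (h0 : ∀ n, 0 ≤ T n)
    (h : ∀ ε > 0, ∃ C, ∀ m, T (m + 1) ≤ T m + C + ε * m) :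
    Tendsto (fun L : ℕ => T L / (L : ℝ) ^ 2) atTop (nhds 0) := by
  rw [Metric.tendsto_atTop]
  intro ε hε
  obtain ⟨C, hC⟩ := h (ε / 2) (by positivity)
  have hT : ∀ L : ℕ, T L ≤ T 0 + C * L + ε / 2 * (L : ℝ) ^ 2 := fun L => by
    induction L with
    | zero => simp
    | succ L ih =>
      have := hC L
      push_cast
      nlinarith [(Nat.cast_nonneg L : (0 : ℝ) ≤ L)]
  -- Beyond this `n` the affine part, divided by `L ^ 2`, is below `ε / 2`.
  obtain ⟨n, hn⟩ := exists_nat_gt ((T 0 + |C|) * 2 / ε)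
  refine ⟨n + 1, fun L hL => ?_⟩
  have hL1 : (1 : ℝ) ≤ L := by exact_mod_cast (Nat.le_add_left 1 n).trans hL
  have hLn : (n : ℝ) ≤ L := by exact_mod_cast (Nat.le_succ n).trans hL
  rw [Real.dist_eq, sub_zero, abs_of_nonneg (div_nonneg (h0 L) (by positivity)),
    div_lt_iff₀ (by positivity)]
  have h1 : (T 0 + |C|) * 2 < ε * L := by
    rw [div_lt_iff₀ hε] at hn
    nlinarith
  have h2 : C * L ≤ |C| * L := mul_le_mul_of_nonneg_right (le_abs_self C) (by positivity)
  have h3 := hT L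
  have h4 : T 0 ≤ T 0 * L := le_mul_of_one_le_right (h0 0) hL1
  nlinarith

theorem tendsto_div_of_sq_le {e T : ℕ → ℝ} (h : ∀ n, e n ^ 2 ≤ 2 * T n)
    (hT : Tendsto (fun L : ℕ => T L / (L : ℝ) ^ 2) atTop (nhds 0)) :
    Tendsto (fun L : ℕ => e L / L) atTop (nhds 0) := by
  have h1 : Tendsto (fun L : ℕ => √(2 * (T L / (L : ℝ) ^ 2))) atTop (nhds 0) := by
    simpa using (hT.const_mul 2).sqrt
  refine squeeze_zero_norm (fun L => ?_) h1
  rw [Real.norm_eq_abs]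
  refine Real.abs_le_sqrt ?_
  rw [div_pow, ← mul_div_assoc]
  exact div_le_div_of_nonneg_right (h L) (by positivity)

theorem average_mem_Icc {r : ℕ → ℝ} {C : ℝ} (hr : ∀ l, r l ∈ Set.Icc 0 C) (L : ℕ) :
    (1 / (L : ℝ)) * ∑ l ∈ Finset.range L, r l ∈ Set.Icc 0 C := by
  have hC : 0 ≤ C := (hr 0).1.trans (hr 0).2
  refine ⟨mul_nonneg (by positivity) (Finset.sum_nonneg fun l _ => (hr l).1), ?_⟩
  rcases L.eq_zero_or_pos with rfl | hL
  -- The empty average is `0`.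
  · simpa using hC
  · have h := Finset.sum_le_sum fun l (_ : l ∈ Finset.range L) => (hr l).2
    have hL' : (0 : ℝ) < L := by exact_mod_cast hL
    rw [Finset.sum_const, Finset.card_range, nsmul_eq_mul] at h
    rw [one_div, inv_mul_le_iff₀ hL']
    exact h

theorem le_of_le_liminf_of_tendsto {u : ℕ → ℝ} {ψ : ℕ → ℕ} (hψ : StrictMono ψ) {a b C : ℝ}
    (hu : ∀ n, u n ∈ Set.Icc 0 C) (h : b ≤ liminf u atTop)
    (ha : Tendsto (u ∘ ψ) atTop (nhds a)) : b ≤ a := by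
  refine le_of_forall_lt_imp_le_of_dense fun c hc => ?_
  have h1 : ∀ᶠ n in atTop, c < u n := eventually_lt_of_lt_liminf (hc.trans_le h)
    (isBoundedUnder_of ⟨0, fun n => (hu n).1⟩)
  exact ge_of_tendsto ha ((hψ.tendsto_atTop.eventually h1).mono fun n hn => hn.le)

theorem le_of_limsup_le_of_tendsto {u : ℕ → ℝ} {ψ : ℕ → ℕ} (hψ : StrictMono ψ) {a b C : ℝ}
    (hu : ∀ n, u n ∈ Set.Icc 0 C) (h : limsup u atTop ≤ b)
    (ha : Tendsto (u ∘ ψ) atTop (nhds a)) : a ≤ b := by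
  refine le_of_forall_gt_imp_ge_of_dense fun c hc => ?_
  have h1 : ∀ᶠ n in atTop, u n < c := eventually_lt_of_limsup_lt (h.trans_lt hc)
    (isBoundedUnder_of ⟨C, fun n => (hu n).2⟩)
  exact le_of_tendsto ha ((hψ.tendsto_atTop.eventually h1).mono fun n hn => hn.le)

end RealSequences

/-! ### Concavity, continuity and Jensen for extended-valued utilities -/

section Utility

variable {K : ℕ} {φ : (Fin K → ℝ) → EReal}

theorem isClosed_orthant : IsClosed (orthant K) := by
  rw [show orthant K = ⋂ i, {q : Fin K → ℝ | 0 ≤ q i} by ext; simp [orthant]]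
  exact isClosed_iInter fun i => isClosed_le continuous_const (continuous_apply i)

theorem convex_orthant : Convex ℝ (orthant K) := fun _ hp _ hq _ _ ha hb _ i =>
  add_nonneg (mul_nonneg ha (hp i)) (mul_nonneg hb (hq i))

theorem IsUtility.coe_toReal (hφ : IsUtility φ) {q : Fin K → ℝ} (hq : q ∈ orthant K)
    (hb : φ q ≠ ⊥) : ((φ q).toReal : EReal) = φ q := EReal.coe_toReal (hφ.ne_top q hq) hb

theorem IsUtility.concaveOn_toReal (hφ : IsUtility φ) :
    ConcaveOn ℝ {q | q ∈ orthant K ∧ φ q ≠ ⊥} fun q => (φ q).toReal := by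
  have key : ∀ p, p ∈ orthant K → φ p ≠ ⊥ → ∀ q, q ∈ orthant K → φ q ≠ ⊥ → ∀ a b : ℝ, 0 < a →
      0 < b → a + b = 1 → ((a * (φ p).toReal + b * (φ q).toReal : ℝ) : EReal) ≤
        φ (a • p + b • q) := fun p hp hp' q hq hq' a b ha hb hab => by
    have h := hφ.concave p hp q hq a b ha hb hab
    rw [← hφ.coe_toReal hp hp', ← hφ.coe_toReal hq hq'] at h
    exact_mod_cast h
  have hne : ∀ p, p ∈ orthant K → φ p ≠ ⊥ → ∀ q, q ∈ orthant K → φ q ≠ ⊥ → ∀ a b : ℝ, 0 < a →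
      0 < b → a + b = 1 → φ (a • p + b • q) ≠ ⊥ := fun p hp hp' q hq hq' a b ha hb hab hbot => by
    have h := key p hp hp' q hq hq' a b ha hb hab
    rw [hbot, le_bot_iff] at h
    exact EReal.coe_ne_bot _ h
  refine concaveOn_iff_forall_pos.2 ⟨convex_iff_forall_pos.2 ?_, ?_⟩
  · exact fun p hp q hq a b ha hb hab => ⟨convex_orthant hp.1 hq.1 ha.le hb.le hab,
      hne p hp.1 hp.2 q hq.1 hq.2 a b ha hb hab⟩
  · intro p hp q hq a b ha hb hab
    have h := key p hp.1 hp.2 q hq.1 hq.2 a b ha hb hab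
    rw [← hφ.coe_toReal (convex_orthant hp.1 hq.1 ha.le hb.le hab)
      (hne p hp.1 hp.2 q hq.1 hq.2 a b ha hb hab)] at h
    exact_mod_cast h

theorem IsUtility.superlevel_eq (hφ : IsUtility φ) (C : ℝ) :
    {q | q ∈ orthant K ∧ (C : EReal) ≤ φ q}
      = {q ∈ {q | q ∈ orthant K ∧ φ q ≠ ⊥} | C ≤ (φ q).toReal} := by
  ext q
  simp only [Set.mem_ofPred_eq, and_assoc, and_congr_right_iff]
  intro hq
  constructor
  · intro h
    have hb : φ q ≠ ⊥ := fun hb => by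
      rw [hb, le_bot_iff] at h
      exact EReal.coe_ne_bot _ h
    refine ⟨hb, ?_⟩
    rw [← hφ.coe_toReal hq hb] at h
    exact_mod_cast h
  · rintro ⟨hb, h⟩
    rw [← hφ.coe_toReal hq hb]
    exact_mod_cast h

/-- The set where `φ` is finite need not be closed, as Jensen's inequality requires. The superlevel
set `{C ≤ φ}` is closed and convex, and `φ` is real-valued and continuous on it; hence the uniform
lower bound `C`. -/
theorem IsUtility.le_map_integral (hφ : IsUtility φ) {Ω : Type*} [MeasurableSpace Ω]
    {μ : Measure Ω} [IsProbabilityMeasure μ] {f : Ω → Fin K → ℝ} (hf : ∀ ω, f ω ∈ orthant K)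
    {C : ℝ} (hC : ∀ ω, (C : EReal) ≤ φ (f ω)) (hfi : Integrable f μ)
    (hφi : Integrable (fun ω => (φ (f ω)).toReal) μ) :
    (∫ ω, f ω ∂μ) ∈ {q | q ∈ orthant K ∧ φ q ≠ ⊥} ∧
      ∫ ω, (φ (f ω)).toReal ∂μ ≤ (φ (∫ ω, f ω ∂μ)).toReal := by
  have hsub : {q | q ∈ orthant K ∧ (C : EReal) ≤ φ q} ⊆ {q | q ∈ orthant K ∧ φ q ≠ ⊥} := by
    rw [hφ.superlevel_eq C]
    exact Set.sep_subset _ _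
  have hconv : Convex ℝ {q | q ∈ orthant K ∧ (C : EReal) ≤ φ q} := by
    rw [hφ.superlevel_eq C]
    exact hφ.concaveOn_toReal.convex_ge C
  have hclosed : IsClosed {q | q ∈ orthant K ∧ (C : EReal) ≤ φ q} :=
    hφ.continuousOn.preimage_isClosed_of_isClosed isClosed_orthant isClosed_Ici
  have hcont : ContinuousOn (fun q => (φ q).toReal) {q | q ∈ orthant K ∧ (C : EReal) ≤ φ q} :=
    EReal.continuousOn_toReal.comp (hφ.continuousOn.mono fun q hq => hq.1) fun q hq => by
      simp only [Set.mem_compl_iff, Set.mem_insert_iff, Set.mem_singleton_iff, not_or]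
      exact ⟨(hsub hq).2, hφ.ne_top q hq.1⟩
  have hmem : ∀ᵐ ω ∂μ, f ω ∈ {q | q ∈ orthant K ∧ (C : EReal) ≤ φ q} :=
    Eventually.of_forall fun ω => ⟨hf ω, hC ω⟩
  exact ⟨hsub (hconv.integral_mem hclosed hmem hfi),
    (hφ.concaveOn_toReal.subset hsub hconv).le_map_integral hcont hclosed hmem hfi hφi⟩

theorem IsUtility.measurable_toReal_comp (hφ : IsUtility φ) {α : Type*} [MeasurableSpace α]
    {f : α → Fin K → ℝ} (hf : Measurable f) (hfo : ∀ a, f a ∈ orthant K) :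
    Measurable fun a => (φ (f a)).toReal := by
  have h1 : Measurable ((orthant K).domRestrict φ) := hφ.continuousOn.domRestrict.measurable
  exact measurable_ereal_toReal.comp
    (h1.comp (hf.subtype_mk (p := (· ∈ orthant K)) (h := hfo)))

theorem IsUtility.tendsto (hφ : IsUtility φ) {u : ℕ → Fin K → ℝ} {q : Fin K → ℝ}
    (hu : ∀ n, u n ∈ orthant K) (hq : Tendsto u atTop (nhds q)) :
    q ∈ orthant K ∧ Tendsto (fun n => φ (u n)) atTop (nhds (φ q)) := by
  have hqo := isClosed_orthant.mem_of_tendsto hq (Eventually.of_forall hu)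
  exact ⟨hqo, (hφ.continuousOn q hqo).tendsto.comp
    (tendsto_nhdsWithin_iff.2 ⟨hq, Eventually.of_forall hu⟩)⟩

theorem IsAux.le {P : Params} (hφ : IsUtility φ) (hV : 0 < P.V) {G γ : Fin K → ℝ}
    (h : IsAux P φ G γ) {g : Fin K → ℝ} (hg : ∀ i, 0 ≤ g i ∧ g i ≤ P.Ppeak) (hb : φ g ≠ ⊥) :
    φ γ ≠ ⊥ ∧ P.V * (φ g).toReal - ∑ i, G i * g i ≤ P.V * (φ γ).toReal - ∑ i, G i * γ i := by
  have hmin := isMinOn_iff.1 h.2 g hg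
  rw [← hφ.coe_toReal (fun i => (hg i).1) hb] at hmin
  -- Otherwise the objective would be `⊤` at the minimizer but finite at `g`.
  have hγ : φ γ ≠ ⊥ := fun hbot => by
    rw [hbot, EReal.coe_mul_bot_of_pos hV, EReal.neg_bot, EReal.top_add_coe, top_le_iff] at hmin
    rw [← EReal.coe_mul, ← EReal.coe_neg, ← EReal.coe_add] at hmin
    exact EReal.coe_ne_top _ hmin
  refine ⟨hγ, ?_⟩
  rw [← hφ.coe_toReal (fun i => (h.1 i).1) hγ] at hmin
  have : -(P.V * (φ γ).toReal) + ∑ i, G i * γ i ≤ -(P.V * (φ g).toReal) + ∑ i, G i * g i := by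
    exact_mod_cast hmin
  linarith

theorem IsUtility.toReal_le (hφ : IsUtility φ) {p q : Fin K → ℝ} (hp : p ∈ orthant K)
    (hq : q ∈ orthant K) (hb : φ p ≠ ⊥) (h : p ≤ q) : (φ p).toReal ≤ (φ q).toReal :=
  EReal.toReal_le_toReal (hφ.monotoneOn hp hq h) hb (hφ.ne_top q hq)

end Utility

end WPT

/-! ### Targets from feasible policies and the expected drift -/

namespace WPT

set_option linter.unusedSectionVars false

variable {K M N : ℕ} {Ω : Type*} [MeasurableSpace Ω] {μ : Measure Ω} [IsProbabilityMeasure μ]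
  {P : Params} {H : ℕ → Ω → Channel K M N} {x y : Causal K M N (Signal N)}
  {γ : Causal K M N (Fin K → ℝ)} {φ : (Fin K → ℝ) → EReal}

theorem IsModel.avgRecv_mem (hM : IsModel P μ H) (hy : ∀ l h, ‖y l h‖ ^ 2 ≤ P.Ppeak) (L : ℕ)
    (i : Fin K) : avgRecv μ H P.η y L i ∈ Set.Icc 0 P.Ppeak :=
  average_mem_Icc (fun l => integral_mem_Icc
    (Eventually.of_forall fun _ => recvPower_nonneg hM.eta_nonneg _ _)
    ((hM.recv_le hy l).mono fun _ h => h i)) L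

theorem avgSent_mem (H : ℕ → Ω → Channel K M N) (hy : ∀ l h, ‖y l h‖ ^ 2 ≤ P.Ppeak) (L : ℕ) :
    avgSent μ H y L ∈ Set.Icc 0 P.Ppeak :=
  average_mem_Icc (fun l => integral_mem_Icc (Eventually.of_forall fun _ => by positivity)
    (Eventually.of_forall fun _ => hy _ _)) L

/-- The sign of `Pavg` is not assumed; it follows from the existence of a feasible policy, whose
average sent powers are nonnegative. -/
theorem Feasible.avg_nonneg (hy : Feasible P μ H y) : 0 ≤ P.Pavg := by
  refine le_trans ?_ hy.avgPower
  exact le_limsup_of_le (isBoundedUnder_of ⟨P.Ppeak, fun L => (avgSent_mem H hy.peakPower L).2⟩)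
    fun b hb => by
      obtain ⟨L, hL⟩ := hb.exists
      exact (avgSent_mem H hy.peakPower L).1.trans hL

/-- Average received powers `q` and average transmit power `s` that satisfy the constraints, and
that are dominated in every slot by the signals `x` with respect to the weights of that slot. -/
structure IsTarget (P : Params) (μ : Measure Ω) (H : ℕ → Ω → Channel K M N)
    (x : Causal K M N (Signal N)) (γ : Causal K M N (Fin K → ℝ)) (q : Fin K → ℝ) (s : ℝ) :
    Prop where
  nonneg : ∀ i, 0 ≤ q i
  le_peak : ∀ i, q i ≤ P.Ppeak
  min_le : ∀ i, P.Pmin ≤ q i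
  le_avg : s ≤ P.Pavg
  dominated : ∀ m, ∑ i, (∫ ω, (queueZ P x (path H ω) m i + queueG P x γ (path H ω) m i) ∂μ) * q i
      - (∫ ω, queueAP P x (path H ω) m ∂μ) * s
    ≤ ∫ ω, (∑ i, (queueZ P x (path H ω) m i + queueG P x γ (path H ω) m i)
        * recvPower P.η (H m ω i) (x m (hist (path H ω) m))
      - queueAP P x (path H ω) m * ‖x m (hist (path H ω) m)‖ ^ 2) ∂μ

theorem weighted_average_le {ι : Type*} [Fintype ι] {w : ι → ℝ} {a R : ℝ} {r : ℕ → ι → ℝ}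
    {s : ℕ → ℝ} (h : ∀ l, ∑ i, w i * r l i - a * s l ≤ R) {L : ℕ} (hL : 0 < L) :
    ∑ i, w i * ((1 / (L : ℝ)) * ∑ l ∈ Finset.range L, r l i)
      - a * ((1 / (L : ℝ)) * ∑ l ∈ Finset.range L, s l) ≤ R := by
  have hL' : (0 : ℝ) < L := by exact_mod_cast hL
  have h1 := Finset.sum_le_sum fun l (_ : l ∈ Finset.range L) => h l
  rw [Finset.sum_const, Finset.card_range, nsmul_eq_mul] at h1
  have h2 : ∑ i, w i * ((1 / (L : ℝ)) * ∑ l ∈ Finset.range L, r l i)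
      - a * ((1 / (L : ℝ)) * ∑ l ∈ Finset.range L, s l)
      = (1 / (L : ℝ)) * ∑ l ∈ Finset.range L, (∑ i, w i * r l i - a * s l) := by
    rw [Finset.sum_sub_distrib, mul_sub, Finset.sum_comm, ← Finset.mul_sum, mul_left_comm a]
    congr 1
    rw [Finset.mul_sum]
    refine Finset.sum_congr rfl fun i _ => ?_
    rw [← Finset.mul_sum, mul_left_comm]
  rw [h2, one_div, inv_mul_le_iff₀ hL']
  exact h1

/-- The averages of `y` lie in a compact box. Along a subsequence realizing `b` they converge, and
the constraints, the dominance inequality (linear in the powers) and the bound on `φ` pass to the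
limit. -/
theorem exists_isTarget (hM : IsModel P μ H) (hφ : IsUtility φ) (hx : IsQFWPT P φ x γ)
    (hy : Feasible P μ H y) {b : EReal} (hb : ∃ᶠ L in atTop, b ≤ φ (avgRecv μ H P.η y L)) :
    ∃ q s, IsTarget P μ H x γ q s ∧ b ≤ φ q := by
  obtain ⟨ψ, hψ, hψb⟩ := extraction_of_frequently_atTop hb
  have hmem : ∀ n, (avgRecv μ H P.η y (ψ n), avgSent μ H y (ψ n))
      ∈ Set.Icc (0 : (Fin K → ℝ) × ℝ) (fun _ => P.Ppeak, P.Ppeak) := fun n =>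
    ⟨⟨fun i => (hM.avgRecv_mem hy.peakPower _ i).1, (avgSent_mem H hy.peakPower _).1⟩,
      ⟨fun i => (hM.avgRecv_mem hy.peakPower _ i).2, (avgSent_mem H hy.peakPower _).2⟩⟩
  obtain ⟨⟨q, s⟩, hqs, ρ, hρ, hlim⟩ := isCompact_Icc.tendsto_subseq hmem
  have hψρ := hψ.comp hρ
  have hq : Tendsto (fun n => avgRecv μ H P.η y (ψ (ρ n))) atTop (nhds q) :=
    (continuous_fst.tendsto _).comp hlim
  have hs : Tendsto (fun n => avgSent μ H y (ψ (ρ n))) atTop (nhds s) :=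
    (continuous_snd.tendsto _).comp hlim
  have hqi : ∀ i, Tendsto (fun n => avgRecv μ H P.η y (ψ (ρ n)) i) atTop (nhds (q i)) :=
    tendsto_pi_nhds.1 hq
  refine ⟨q, s, ⟨hqs.1.1, hqs.2.1, fun i => ?_, ?_, fun m => ?_⟩, ?_⟩
  · exact le_of_le_liminf_of_tendsto hψρ (fun L => hM.avgRecv_mem hy.peakPower L i)
      (hy.minRecv i) (hqi i)
  · exact le_of_limsup_le_of_tendsto hψρ (fun L => avgSent_mem H hy.peakPower L) hy.avgPower hs
  · refine le_of_tendsto ((tendsto_finsetSum _ fun i _ => (hqi i).const_mul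
      (∫ ω, (queueZ P x (path H ω) m i + queueG P x γ (path H ω) m i) ∂μ)).sub
      (hs.const_mul (∫ ω, queueAP P x (path H ω) m ∂μ))) ?_
    filter_upwards [hψρ.tendsto_atTop.eventually (eventually_gt_atTop 0)] with n hn
    exact weighted_average_le
      (fun l => expected_weighted_le hM hx hy.avg_nonneg hy.measurable hy.peakPower l m) hn
  · exact ge_of_tendsto (hφ.tendsto (fun n i => (hM.avgRecv_mem hy.peakPower _ i).1) hq).2
      (Eventually.of_forall fun n => hψb _)

section Expectations

theorem integrable_queueG (hM : IsModel P μ H) (hx : IsQFWPT P φ x γ) (l : ℕ) (i : Fin K) :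
    Integrable (fun ω => queueG P x γ (path H ω) l i) μ :=
  integrable_of_abs_le (measurable_queueG_path hM hx l i) (C := l * P.Ppeak)
    (Eventually.of_forall fun ω => by
      rw [abs_of_nonneg (queueG_nonneg _ _ _)]; exact hx.queueG_le hM _ _ _)

theorem integrable_queueZ (hM : IsModel P μ H) (hx : IsQFWPT P φ x γ) (l : ℕ) (i : Fin K) :
    Integrable (fun ω => queueZ P x (path H ω) l i) μ :=
  integrable_of_abs_le (measurable_queueZ_path hM hx l i) (C := l * P.Pmin)
    (Eventually.of_forall fun ω => by
      rw [abs_of_nonneg (queueZ_nonneg _ _ _)]; exact queueZ_le hM.eta_nonneg hM.min_nonneg _ _ _)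

theorem integrable_queueAP (hM : IsModel P μ H) (hx : IsQFWPT P φ x γ) (havg : 0 ≤ P.Pavg)
    (l : ℕ) : Integrable (fun ω => queueAP P x (path H ω) l) μ :=
  integrable_of_abs_le (measurable_queueAP_path hM hx l) (C := l * P.Ppeak)
    (Eventually.of_forall fun ω => by
      rw [abs_of_nonneg (queueAP_nonneg _ _)]; exact hx.queueAP_le hM havg _ _)

theorem integrable_sq_of_le {f : Ω → ℝ} (hf : Measurable f) {C : ℝ} (h0 : ∀ ω, 0 ≤ f ω)
    (hC : ∀ ω, f ω ≤ C) : Integrable (fun ω => f ω ^ 2) μ :=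
  integrable_of_abs_le (hf.pow_const 2) (C := C ^ 2) (Eventually.of_forall fun ω => by
    rw [abs_of_nonneg (sq_nonneg _)]; exact pow_le_pow_left₀ (h0 ω) (hC ω) 2)

theorem integrable_lyapunov (hM : IsModel P μ H) (hx : IsQFWPT P φ x γ) (havg : 0 ≤ P.Pavg)
    (l : ℕ) : Integrable (fun ω => lyapunov P x γ (path H ω) l) μ :=
  ((integrable_finsetSum _ fun i _ =>
    (integrable_sq_of_le (measurable_queueG_path hM hx l i) (fun _ => queueG_nonneg _ _ _)
      (fun _ => hx.queueG_le hM _ _ _)).add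
    (integrable_sq_of_le (measurable_queueZ_path hM hx l i) (fun _ => queueZ_nonneg _ _ _)
      (fun _ => queueZ_le hM.eta_nonneg hM.min_nonneg _ _ _))).add
    (integrable_sq_of_le (measurable_queueAP_path hM hx l) (fun _ => queueAP_nonneg _ _)
      (fun _ => hx.queueAP_le hM havg _ _))).div_const 2

theorem lyapunov_nonneg (c : ℕ → Channel K M N) (l : ℕ) : 0 ≤ lyapunov P x γ c l := by
  unfold lyapunov
  positivity

theorem lyapunov_zero (c : ℕ → Channel K M N) : lyapunov P x γ c 0 = 0 := by
  simp [lyapunov, queueG, queueZ, queueAP]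

/-- Nonnegativity of the variance gives `(E f) ^ 2 ≤ E (f ^ 2)`. -/
theorem sq_integral_le_lyapunov (hM : IsModel P μ H) (hx : IsQFWPT P φ x γ) (havg : 0 ≤ P.Pavg)
    (l : ℕ) {f : Ω → ℝ} (hf : Measurable f) (hfl : ∀ ω, f ω ^ 2 ≤ 2 * lyapunov P x γ (path H ω) l) :
    (∫ ω, f ω ∂μ) ^ 2 ≤ 2 * ∫ ω, lyapunov P x γ (path H ω) l ∂μ := by
  have hi := (integrable_lyapunov hM hx havg l).const_mul 2
  have hf2 : Integrable (fun ω => f ω ^ 2) μ := hi.mono' (hf.pow_const 2).aestronglyMeasurable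
    (Eventually.of_forall fun ω => by
      rw [Real.norm_eq_abs, abs_of_nonneg (sq_nonneg _)]; exact hfl ω)
  have hL : MemLp f 2 μ := (memLp_two_iff_integrable_sq hf.aestronglyMeasurable).2 hf2
  have hv := variance_nonneg f μ
  rw [variance_eq_sub hL] at hv
  have h1 := integral_mono hf2 hi hfl
  rw [integral_const_mul] at h1
  exact (sub_nonneg.1 hv).trans h1

theorem sq_queueG_le (c : ℕ → Channel K M N) (l : ℕ) (i : Fin K) :
    queueG P x γ c l i ^ 2 ≤ 2 * lyapunov P x γ c l := by
  have h := Finset.single_le_sum (f := fun i => queueG P x γ c l i ^ 2 + queueZ P x c l i ^ 2)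
    (fun i _ => by positivity) (Finset.mem_univ i)
  unfold lyapunov
  nlinarith [sq_nonneg (queueZ P x c l i), sq_nonneg (queueAP P x c l)]

theorem sq_queueZ_le (c : ℕ → Channel K M N) (l : ℕ) (i : Fin K) :
    queueZ P x c l i ^ 2 ≤ 2 * lyapunov P x γ c l := by
  have h := Finset.single_le_sum (f := fun i => queueG P x γ c l i ^ 2 + queueZ P x c l i ^ 2)
    (fun i _ => by positivity) (Finset.mem_univ i)
  unfold lyapunov
  nlinarith [sq_nonneg (queueG P x γ c l i), sq_nonneg (queueAP P x c l)]

theorem sq_queueAP_le (c : ℕ → Channel K M N) (l : ℕ) :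
    queueAP P x c l ^ 2 ≤ 2 * lyapunov P x γ c l := by
  have h : 0 ≤ ∑ i, (queueG P x γ c l i ^ 2 + queueZ P x c l i ^ 2) := by positivity
  unfold lyapunov
  linarith

theorem IsModel.peak_mem_orthant (hM : IsModel P μ H) :
    (fun _ : Fin K => P.Ppeak) ∈ orthant K := fun _ => hM.peak_pos.le

theorem IsModel.map_peak_ne_bot (hM : IsModel P μ H) (hφ : IsUtility φ) :
    φ (fun _ : Fin K => P.Ppeak) ≠ ⊥ := hφ.ne_bot _ fun _ => hM.peak_pos

theorem aux_ne_bot (hM : IsModel P μ H) (hφ : IsUtility φ)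
    (hx : IsQFWPT P φ x γ) (c : ℕ → Channel K M N) (l : ℕ) : φ (γ l (hist c l)) ≠ ⊥ :=
  ((hx.aux c l).le hφ hM.V_pos (fun _ => ⟨hM.peak_pos.le, le_rfl⟩)
    (hM.map_peak_ne_bot hφ)).1

theorem aux_utility_le (hM : IsModel P μ H) (hφ : IsUtility φ)
    (hx : IsQFWPT P φ x γ) (c : ℕ → Channel K M N) (l : ℕ) :
    (φ (γ l (hist c l))).toReal ≤ (φ fun _ => P.Ppeak).toReal :=
  hφ.toReal_le (fun i => ((hx.aux c l).1 i).1) hM.peak_mem_orthant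
    (aux_ne_bot hM hφ hx c l) fun i => ((hx.aux c l).1 i).2

/-- Comparing the minimizer with the constant vector `Ppeak` costs at most `∑ i, G_i Ppeak ≤ K l
Ppeak ^ 2`. The bound depends on the slot but not on the path, which suffices for integrability and
Jensen even if `φ` reaches `-∞`. -/
theorem exists_le_aux_utility (hM : IsModel P μ H) (hφ : IsUtility φ)
    (hx : IsQFWPT P φ x γ) (l : ℕ) : ∃ C : ℝ, ∀ c : ℕ → Channel K M N,
    C ≤ (φ (γ l (hist c l))).toReal := by
  refine ⟨(φ fun _ => P.Ppeak).toReal - (K * (l * P.Ppeak * P.Ppeak)) / P.V, fun c => ?_⟩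
  have h := ((hx.aux c l).le hφ hM.V_pos (fun _ => ⟨hM.peak_pos.le, le_rfl⟩)
    (hM.map_peak_ne_bot hφ)).2
  have h1 : ∑ i, queueG P x γ c l i * P.Ppeak ≤ K * (l * P.Ppeak * P.Ppeak) := by
    have := Finset.sum_le_sum fun i (_ : i ∈ Finset.univ) =>
      mul_le_mul_of_nonneg_right (hx.queueG_le hM c l i) hM.peak_pos.le
    simpa using this
  have h2 : 0 ≤ ∑ i, queueG P x γ c l i * γ l (hist c l) i :=
    Finset.sum_nonneg fun i _ => mul_nonneg (queueG_nonneg _ _ _) ((hx.aux c l).1 i).1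
  have hV := hM.V_pos
  rw [sub_le_iff_le_add, ← sub_le_iff_le_add', le_div_iff₀ hV]
  linarith

theorem integrable_aux_utility (hM : IsModel P μ H) (hφ : IsUtility φ)
    (hx : IsQFWPT P φ x γ) (l : ℕ) :
    Integrable (fun ω => (φ (γ l (hist (path H ω) l))).toReal) μ := by
  obtain ⟨C, hC⟩ := exists_le_aux_utility hM hφ hx l
  refine integrable_of_abs_le (hφ.measurable_toReal_comp
    ((hx.measurable_aux l).comp (measurable_hist fun j _ => hM.measurable j))
    fun ω i => ((hx.aux _ l).1 i).1) (C := max |C| |(φ fun _ => P.Ppeak).toReal|)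
    (Eventually.of_forall fun ω => ?_)
  exact abs_le_max_abs_abs (hC _) (aux_utility_le hM hφ hx _ _)

theorem integrable_aux (hM : IsModel P μ H) (hx : IsQFWPT P φ x γ) (l : ℕ) :
    Integrable (fun ω => γ l (hist (path H ω) l)) μ := by
  refine Integrable.of_bound ((hx.measurable_aux l).comp
    (measurable_hist fun j _ => hM.measurable j)).aestronglyMeasurable P.Ppeak
    (Eventually.of_forall fun ω => (pi_norm_le_iff_of_nonneg hM.peak_pos.le).2 fun i => ?_)
  have h := (hx.aux (path H ω) l).1 i
  rw [Real.norm_eq_abs, abs_of_nonneg h.1]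
  exact h.2

/-- One step of the expected Lyapunov drift, compared with a target `q` and fixed values `g` of
the auxiliary variables. -/
theorem expected_drift_le (hM : IsModel P μ H) (hφ : IsUtility φ)
    (hx : IsQFWPT P φ x γ) (havg : 0 ≤ P.Pavg) {q : Fin K → ℝ} {s : ℝ}
    (hq : IsTarget P μ H x γ q s) {g : Fin K → ℝ} (hg : ∀ i, 0 ≤ g i ∧ g i ≤ P.Ppeak)
    (hgb : φ g ≠ ⊥) (m : ℕ) :
    ∫ ω, lyapunov P x γ (path H ω) (m + 1) ∂μ ≤ ∫ ω, lyapunov P x γ (path H ω) m ∂μ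
      + (2 * K + 1) / 2 * P.Ppeak ^ 2
      + P.V * ∫ ω, (φ (γ m (hist (path H ω) m))).toReal ∂μ - P.V * (φ g).toReal
      + ∑ i, (∫ ω, queueG P x γ (path H ω) m i ∂μ) * (g i - q i) := by
  set D : Ω → ℝ := fun ω => ∑ i, (queueZ P x (path H ω) m i + queueG P x γ (path H ω) m i)
        * recvPower P.η (H m ω i) (x m (hist (path H ω) m))
      - queueAP P x (path H ω) m * ‖x m (hist (path H ω) m)‖ ^ 2 with hD
  have hDi : Integrable D μ := integrable_weighted hM hx havg m
  have hLi := integrable_lyapunov hM hx havg m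
  have hUi := integrable_aux_utility hM hφ hx m
  have hGi := integrable_queueG (μ := μ) hM hx m
  have hZi := integrable_queueZ (μ := μ) hM hx m
  have hAi := integrable_queueAP (μ := μ) hM hx havg m
  have hpeak := hx.peakPower hM.peak_pos.le
  have hpt : ∀ᵐ ω ∂μ, lyapunov P x γ (path H ω) (m + 1) ≤ lyapunov P x γ (path H ω) m
      + P.V * (φ (γ m (hist (path H ω) m))).toReal - D ω
      + ∑ i, (queueG P x γ (path H ω) m i * g i + queueZ P x (path H ω) m i * P.Pmin)
      - queueAP P x (path H ω) m * P.Pavg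
      + ((2 * K + 1) / 2 * P.Ppeak ^ 2 - P.V * (φ g).toReal) := by
    filter_upwards [hM.recv_le hpeak m] with ω hω
    have h1 := lyapunov_succ_le (x := x) (γ := γ) (c := path H ω) hM.eta_nonneg hM.min_nonneg
      (fun i => (hq.min_le i).trans (hq.le_peak i)) havg (fun l => hpeak l _)
      (fun l i => (hx.aux (path H ω) l).1 i) m hω
    have h2 := ((hx.aux (path H ω) m).le hφ hM.V_pos hg hgb).2
    simp only [hD, Finset.sum_add_distrib, Finset.sum_sub_distrib, mul_sub, add_mul] at h1 h2 ⊢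
    linarith
  have hSi : Integrable (fun ω => ∑ i, (queueG P x γ (path H ω) m i * g i
      + queueZ P x (path H ω) m i * P.Pmin)) μ :=
    integrable_finsetSum _ fun i _ => ((hGi i).mul_const _).add ((hZi i).mul_const _)
  have h1 := (hLi.add (hUi.const_mul P.V))
  have h2 := h1.sub hDi
  have h3 := h2.add hSi
  have h4 := h3.sub (hAi.mul_const P.Pavg)
  have hfin := integral_mono_ae (integrable_lyapunov hM hx havg (m + 1))
    (h4.add (integrable_const ((2 * K + 1) / 2 * P.Ppeak ^ 2 - P.V * (φ g).toReal))) hpt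
  rw [integral_add' h4 (integrable_const _), integral_sub' h3 (hAi.mul_const _),
    integral_add' h2 hSi, integral_sub' h1 hDi, integral_add' hLi (hUi.const_mul _),
    integral_const_mul, integral_mul_const, integral_const, probReal_univ, one_smul] at hfin
  have hs : ∫ ω, ∑ i, (queueG P x γ (path H ω) m i * g i
      + queueZ P x (path H ω) m i * P.Pmin) ∂μ
      = ∑ i, ((∫ ω, queueG P x γ (path H ω) m i ∂μ) * g i
        + (∫ ω, queueZ P x (path H ω) m i ∂μ) * P.Pmin) := by
    rw [integral_finsetSum]
    · refine Finset.sum_congr rfl fun i _ => ?_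
      rw [integral_add ((hGi i).mul_const _) ((hZi i).mul_const _), integral_mul_const,
        integral_mul_const]
    · exact fun i _ => ((hGi i).mul_const _).add ((hZi i).mul_const _)
  rw [hs] at hfin
  have hdom : _ ≤ ∫ ω, D ω ∂μ := hq.dominated m
  have hw : ∀ i, ∫ ω, (queueZ P x (path H ω) m i + queueG P x γ (path H ω) m i) ∂μ
      = ∫ ω, queueZ P x (path H ω) m i ∂μ + ∫ ω, queueG P x γ (path H ω) m i ∂μ := fun i =>
    integral_add (hZi i) (hGi i)
  -- The target meets `Pmin ≤ q_i` and `s ≤ Pavg`, so the nonnegative mean queues `Z_i` and `Z_AP`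
  -- contribute nothing positive and only the `G` terms survive.
  have hzq := Finset.sum_le_sum fun i (_ : i ∈ Finset.univ) =>
    mul_le_mul_of_nonneg_left (hq.min_le i)
      (integral_nonneg (μ := μ) fun ω => queueZ_nonneg (P := P) (x := x) (path H ω) m i)
  have has := mul_le_mul_of_nonneg_left hq.le_avg
    (integral_nonneg (μ := μ) fun ω => queueAP_nonneg (P := P) (x := x) (path H ω) m)
  simp only [hw, Finset.sum_add_distrib, Finset.sum_sub_distrib, mul_sub, add_mul]
    at hfin hdom hzq ⊢
  linarith

end Expectations

end WPT

/-! ### Queue stability, feasibility and the utility bound -/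

namespace WPT

set_option linter.unusedSectionVars false

variable {K M N : ℕ} {Ω : Type*} [MeasurableSpace Ω] {μ : Measure Ω} [IsProbabilityMeasure μ]
  {P : Params} {H : ℕ → Ω → Channel K M N} {x y : Causal K M N (Signal N)}
  {γ : Causal K M N (Fin K → ℝ)} {φ : (Fin K → ℝ) → EReal}

/-- A queue started empty is at least the accumulated arrivals minus services. -/
theorem average_sub_le_of_queue {e a b : ℕ → ℝ} (h0 : e 0 = 0)
    (h : ∀ l, e l + a l - b l ≤ e (l + 1)) (L : ℕ) :
    (1 / (L : ℝ)) * ∑ l ∈ Finset.range L, a l - e L / L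
      ≤ (1 / (L : ℝ)) * ∑ l ∈ Finset.range L, b l := by
  have hs : ∑ l ∈ Finset.range L, a l - ∑ l ∈ Finset.range L, b l ≤ e L := by
    induction L with
    | zero => simp [h0]
    | succ L ih =>
      have := h L
      rw [Finset.sum_range_succ, Finset.sum_range_succ]
      linarith
  have h1 := div_le_div_of_nonneg_right hs (Nat.cast_nonneg L : (0 : ℝ) ≤ L)
  rw [sub_div] at h1
  rw [one_div, inv_mul_eq_div, inv_mul_eq_div]
  linarith

theorem average_const {L : ℕ} (hL : 0 < L) (c : ℝ) :
    (1 / (L : ℝ)) * ∑ _l ∈ Finset.range L, c = c := by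
  have hL' : (0 : ℝ) < L := by exact_mod_cast hL
  rw [Finset.sum_const, Finset.card_range, nsmul_eq_mul]
  field_simp

/-- The utility may be `⊥` at the target, so `g` is moved towards the peak to have positive entries.
The price `E[G_i] (g_i - q_i)` is linear in `m` with arbitrarily small slope, since `G_i[m] ≤ m
Ppeak`. -/
theorem expected_lyapunov_div_sq_tendsto (hM : IsModel P μ H) (hφ : IsUtility φ)
    (hx : IsQFWPT P φ x γ) (hy : Feasible P μ H y) :
    Tendsto (fun L : ℕ => (∫ ω, lyapunov P x γ (path H ω) L ∂μ) / (L : ℝ) ^ 2) atTop (nhds 0) := by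
  obtain ⟨q, s, hq, -⟩ := exists_isTarget (b := ⊥) hM hφ hx hy
    (Eventually.of_forall fun _ => bot_le).frequently
  refine tendsto_div_sq_of_forall_drift_le
    (fun L => integral_nonneg fun ω => lyapunov_nonneg _ _) fun ε hε => ?_
  have hP := hM.peak_pos
  -- Makes `K Ppeak ^ 2 δ ≤ ε` while keeping `g` below the peak; the `+ 1` covers `K = 0`.
  set δ : ℝ := min 1 (ε / (K * P.Ppeak ^ 2 + 1)) with hδ
  have hδ0 : 0 < δ := lt_min one_pos (by positivity)
  have hδ1 : δ ≤ 1 := min_le_left _ _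
  have hδε : K * P.Ppeak ^ 2 * δ ≤ ε := by
    have h1 : δ * (K * P.Ppeak ^ 2 + 1) ≤ ε :=
      (le_div_iff₀ (by positivity)).1 (min_le_right _ _)
    linarith
  let g : Fin K → ℝ := fun i => q i + δ * (P.Ppeak - q i)
  have hgpos : ∀ i, 0 < g i := fun i => by
    have h1 := hq.nonneg i
    have : g i = (1 - δ) * q i + δ * P.Ppeak := by simp only [g]; ring
    rw [this]
    exact add_pos_of_nonneg_of_pos (mul_nonneg (by linarith) h1) (by positivity)
  have hgle : ∀ i, g i ≤ P.Ppeak := fun i => by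
    have := hq.le_peak i
    simp only [g]
    nlinarith
  have hgb : φ g ≠ ⊥ := hφ.ne_bot g hgpos
  refine ⟨(2 * K + 1) / 2 * P.Ppeak ^ 2 + P.V * (φ fun _ => P.Ppeak).toReal
    - P.V * (φ g).toReal, fun m => ?_⟩
  have hdrift := expected_drift_le hM hφ hx hy.avg_nonneg hq (fun i => ⟨(hgpos i).le, hgle i⟩) hgb m
  have hU : ∫ ω, (φ (γ m (hist (path H ω) m))).toReal ∂μ ≤ (φ fun _ => P.Ppeak).toReal := by
    simpa using integral_mono (integrable_aux_utility hM hφ hx m) (integrable_const _)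
      fun ω => aux_utility_le hM hφ hx (path H ω) m
  have hU' := mul_le_mul_of_nonneg_left hU hM.V_pos.le
  have hsum : ∑ i, (∫ ω, queueG P x γ (path H ω) m i ∂μ) * (g i - q i) ≤ ε * m := by
    have h1 : ∀ i, (∫ ω, queueG P x γ (path H ω) m i ∂μ) * (g i - q i)
        ≤ (m * P.Ppeak) * (δ * P.Ppeak) := fun i => by
      have hG := integral_mem_Icc (μ := μ) (f := fun ω => queueG P x γ (path H ω) m i)
        (Eventually.of_forall fun ω => queueG_nonneg _ _ _)
        (Eventually.of_forall fun ω => hx.queueG_le hM _ _ _)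
      have h2 := hq.nonneg i
      have h3 := hq.le_peak i
      have h4 : g i - q i = δ * (P.Ppeak - q i) := by simp only [g]; ring
      rw [h4]
      exact mul_le_mul hG.2 (mul_le_mul_of_nonneg_left (by linarith) hδ0.le)
        (mul_nonneg hδ0.le (by linarith)) (by positivity)
    have h5 := Finset.sum_le_sum fun i (_ : i ∈ Finset.univ) => h1 i
    rw [Finset.sum_const, Finset.card_univ, Fintype.card_fin, nsmul_eq_mul] at h5
    have h6 := mul_le_mul_of_nonneg_right hδε (Nat.cast_nonneg m : (0 : ℝ) ≤ m)
    linarith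
  linarith

theorem expected_queueG_div_tendsto (hM : IsModel P μ H) (hφ : IsUtility φ)
    (hx : IsQFWPT P φ x γ) (hy : Feasible P μ H y) (i : Fin K) :
    Tendsto (fun L : ℕ => (∫ ω, queueG P x γ (path H ω) L i ∂μ) / L) atTop (nhds 0) :=
  tendsto_div_of_sq_le (fun L => sq_integral_le_lyapunov hM hx hy.avg_nonneg L
    (measurable_queueG_path hM hx L i) fun _ => sq_queueG_le _ _ _)
    (expected_lyapunov_div_sq_tendsto hM hφ hx hy)

theorem expected_queueZ_div_tendsto (hM : IsModel P μ H) (hφ : IsUtility φ)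
    (hx : IsQFWPT P φ x γ) (hy : Feasible P μ H y) (i : Fin K) :
    Tendsto (fun L : ℕ => (∫ ω, queueZ P x (path H ω) L i ∂μ) / L) atTop (nhds 0) :=
  tendsto_div_of_sq_le (fun L => sq_integral_le_lyapunov hM hx hy.avg_nonneg L
    (measurable_queueZ_path hM hx L i) fun _ => sq_queueZ_le _ _ _)
    (expected_lyapunov_div_sq_tendsto hM hφ hx hy)

theorem expected_queueAP_div_tendsto (hM : IsModel P μ H) (hφ : IsUtility φ)
    (hx : IsQFWPT P φ x γ) (hy : Feasible P μ H y) :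
    Tendsto (fun L : ℕ => (∫ ω, queueAP P x (path H ω) L ∂μ) / L) atTop (nhds 0) :=
  tendsto_div_of_sq_le (fun L => sq_integral_le_lyapunov hM hx hy.avg_nonneg L
    (measurable_queueAP_path hM hx L) fun _ => sq_queueAP_le _ _)
    (expected_lyapunov_div_sq_tendsto hM hφ hx hy)

theorem avgRecv_ge_min (hM : IsModel P μ H) (hx : IsQFWPT P φ x γ) {L : ℕ} (hL : 0 < L)
    (i : Fin K) :
    P.Pmin - (∫ ω, queueZ P x (path H ω) L i ∂μ) / L ≤ avgRecv μ H P.η x L i := by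
  have h := average_sub_le_of_queue (e := fun l => ∫ ω, queueZ P x (path H ω) l i ∂μ)
    (a := fun _ => P.Pmin)
    (b := fun l => ∫ ω, recvPower P.η (H l ω i) (x l (hist (path H ω) l)) ∂μ)
    (by simp [queueZ]) (fun l => ?_) L
  · rwa [average_const hL] at h
  · have hZ := integrable_queueZ (μ := μ) hM hx l i
    have hQ := hM.integrable_recv hx.measurable_signal (hx.peakPower hM.peak_pos.le) l i
    have h1 := integral_mono ((hZ.add (integrable_const P.Pmin)).sub hQ)
      (integrable_queueZ hM hx (l + 1) i) fun ω => le_max_left _ _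
    rw [integral_sub' (hZ.add (integrable_const _)) hQ, integral_add' hZ (integrable_const _),
      integral_const, probReal_univ, one_smul] at h1
    exact h1

theorem avgRecv_ge_aux (hM : IsModel P μ H) (hx : IsQFWPT P φ x γ) (L : ℕ) (i : Fin K) :
    (1 / (L : ℝ)) * ∑ l ∈ Finset.range L, ∫ ω, γ l (hist (path H ω) l) i ∂μ
      - (∫ ω, queueG P x γ (path H ω) L i ∂μ) / L ≤ avgRecv μ H P.η x L i := by
  refine average_sub_le_of_queue (e := fun l => ∫ ω, queueG P x γ (path H ω) l i ∂μ)
    (a := fun l => ∫ ω, γ l (hist (path H ω) l) i ∂μ)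
    (b := fun l => ∫ ω, recvPower P.η (H l ω i) (x l (hist (path H ω) l)) ∂μ)
    (by simp [queueG]) (fun l => ?_) L
  have hG := integrable_queueG (μ := μ) hM hx l i
  have hγ := (integrable_aux (μ := μ) hM hx l).eval i
  have hQ := hM.integrable_recv hx.measurable_signal (hx.peakPower hM.peak_pos.le) l i
  have h1 := integral_mono ((hG.add hγ).sub hQ)
    (integrable_queueG hM hx (l + 1) i) fun ω => le_max_left _ _
  rw [integral_sub' (hG.add hγ) hQ, integral_add' hG hγ] at h1
  exact h1

theorem avgSent_le (hM : IsModel P μ H) (hx : IsQFWPT P φ x γ) (havg : 0 ≤ P.Pavg) {L : ℕ}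
    (hL : 0 < L) :
    avgSent μ H x L ≤ P.Pavg + (∫ ω, queueAP P x (path H ω) L ∂μ) / L := by
  have h := average_sub_le_of_queue (e := fun l => ∫ ω, queueAP P x (path H ω) l ∂μ)
    (a := fun l => ∫ ω, ‖x l (hist (path H ω) l)‖ ^ 2 ∂μ) (b := fun _ => P.Pavg)
    (by simp [queueAP]) (fun l => ?_) L
  · rw [average_const hL] at h
    exact sub_le_iff_le_add.1 h
  · have hA := integrable_queueAP (μ := μ) hM hx havg l
    have hS := hM.integrable_sent hx.measurable_signal (hx.peakPower hM.peak_pos.le) l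
    have h1 := integral_mono ((hA.add hS).sub (integrable_const P.Pavg))
      (integrable_queueAP hM hx havg (l + 1)) fun ω => le_max_left _ _
    rw [integral_sub' (hA.add hS) (integrable_const _), integral_add' hA hS,
      integral_const, probReal_univ, one_smul] at h1
    exact h1

theorem IsQFWPT.feasible (hM : IsModel P μ H) (hφ : IsUtility φ) (hx : IsQFWPT P φ x γ)
    (hy : Feasible P μ H y) : Feasible P μ H x := by
  have hp := hx.peakPower hM.peak_pos.le
  refine ⟨hx.measurable_signal, fun i => ?_, ?_, hp⟩
  · have h := (tendsto_const_nhds (x := P.Pmin)).sub (expected_queueZ_div_tendsto hM hφ hx hy i)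
    rw [sub_zero] at h
    rw [← h.liminf_eq]
    refine liminf_le_liminf ?_ h.isBoundedUnder_ge
      (isBoundedUnder_of ⟨P.Ppeak, fun L => (hM.avgRecv_mem hp L i).2⟩).isCoboundedUnder_ge
    filter_upwards [eventually_gt_atTop 0] with L hL using avgRecv_ge_min hM hx hL i
  · have h := (tendsto_const_nhds (x := P.Pavg)).add (expected_queueAP_div_tendsto hM hφ hx hy)
    rw [add_zero] at h
    rw [← h.limsup_eq]
    refine limsup_le_limsup ?_
      (isBoundedUnder_of ⟨0, fun L => (avgSent_mem H hp L).1⟩).isCoboundedUnder_le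
      h.isBoundedUnder_le
    filter_upwards [eventually_gt_atTop 0] with L hL using avgSent_le hM hx hy.avg_nonneg hL

theorem average_utility_ge (hM : IsModel P μ H) (hφ : IsUtility φ) (hx : IsQFWPT P φ x γ)
    (havg : 0 ≤ P.Pavg) {q : Fin K → ℝ} {s : ℝ} (hq : IsTarget P μ H x γ q s) (hqb : φ q ≠ ⊥)
    {L : ℕ} (hL : 0 < L) :
    (φ q).toReal - (2 * (K : ℝ) + 1) / 2 * P.Ppeak ^ 2 / P.V
      ≤ (1 / (L : ℝ)) * ∑ l ∈ Finset.range L,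
          ∫ ω, (φ (γ l (hist (path H ω) l))).toReal ∂μ := by
  have hV := hM.V_pos
  have hT : ∀ L : ℕ, ∫ ω, lyapunov P x γ (path H ω) L ∂μ
      ≤ L * ((2 * K + 1) / 2 * P.Ppeak ^ 2 - P.V * (φ q).toReal)
        + P.V * ∑ l ∈ Finset.range L, ∫ ω, (φ (γ l (hist (path H ω) l))).toReal ∂μ := fun L => by
    induction L with
    | zero => simp [lyapunov_zero]
    | succ L ih =>
      have h := expected_drift_le hM hφ hx havg hq (fun i => ⟨hq.nonneg i, hq.le_peak i⟩) hqb L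
      -- With `g = q` the queue term vanishes and the drift telescopes.
      simp only [sub_self, mul_zero, Finset.sum_const_zero] at h
      rw [Finset.sum_range_succ, mul_add]
      push_cast
      linarith
  have h0 : 0 ≤ ∫ ω, lyapunov P x γ (path H ω) L ∂μ :=
    integral_nonneg fun ω => lyapunov_nonneg _ _
  have h1 := h0.trans (hT L)
  have hL' : (0 : ℝ) < L := by exact_mod_cast hL
  rw [one_div, inv_mul_eq_div, le_div_iff₀ hL', sub_mul, sub_le_iff_le_add,
    ← mul_le_mul_iff_right₀ hV]
  have h2 : P.V * ((2 * (K : ℝ) + 1) / 2 * P.Ppeak ^ 2 / P.V * L)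
      = L * ((2 * K + 1) / 2 * P.Ppeak ^ 2) := by field_simp
  rw [mul_add, h2]
  linarith

theorem map_average_aux_ge (hM : IsModel P μ H) (hφ : IsUtility φ) (hx : IsQFWPT P φ x γ)
    (havg : 0 ≤ P.Pavg) {q : Fin K → ℝ} {s : ℝ} (hq : IsTarget P μ H x γ q s) (hqb : φ q ≠ ⊥)
    {L : ℕ} (hL : 0 < L) :
    (((φ q).toReal - (2 * (K : ℝ) + 1) / 2 * P.Ppeak ^ 2 / P.V : ℝ) : EReal)
      ≤ φ fun i => (1 / (L : ℝ)) * ∑ l ∈ Finset.range L, ∫ ω, γ l (hist (path H ω) l) i ∂μ := by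
  have hL' : (0 : ℝ) < L := by exact_mod_cast hL
  have hjen : ∀ l, (∫ ω, γ l (hist (path H ω) l) ∂μ) ∈ {q | q ∈ orthant K ∧ φ q ≠ ⊥} ∧
      ∫ ω, (φ (γ l (hist (path H ω) l))).toReal ∂μ
        ≤ (φ (∫ ω, γ l (hist (path H ω) l) ∂μ)).toReal := fun l => by
    obtain ⟨C, hC⟩ := exists_le_aux_utility hM hφ hx l
    refine hφ.le_map_integral (fun ω i => ((hx.aux _ l).1 i).1) (C := C) (fun ω => ?_)
      (integrable_aux hM hx l) (integrable_aux_utility hM hφ hx l)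
    rw [← hφ.coe_toReal (fun i => ((hx.aux (path H ω) l).1 i).1) (aux_ne_bot hM hφ hx _ l)]
    exact_mod_cast hC _
  have hw : ∑ _l ∈ Finset.range L, (1 / (L : ℝ)) = 1 := by
    rw [Finset.sum_const, Finset.card_range, nsmul_eq_mul]
    field_simp
  have hmem := hφ.concaveOn_toReal.1.sum_mem (t := Finset.range L) (w := fun _ => 1 / (L : ℝ))
    (fun _ _ => by positivity) hw fun l _ => (hjen l).1
  have hle := hφ.concaveOn_toReal.le_map_sum (t := Finset.range L) (w := fun _ => 1 / (L : ℝ))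
    (fun _ _ => by positivity) hw fun l _ => (hjen l).1
  have heq : (∑ l ∈ Finset.range L, (1 / (L : ℝ)) • ∫ ω, γ l (hist (path H ω) l) ∂μ)
      = fun i => (1 / (L : ℝ)) * ∑ l ∈ Finset.range L, ∫ ω, γ l (hist (path H ω) l) i ∂μ := by
    funext i
    rw [Finset.sum_apply, Finset.mul_sum]
    refine Finset.sum_congr rfl fun l _ => ?_
    rw [Pi.smul_apply, smul_eq_mul, eval_integral fun i => (integrable_aux hM hx l).eval i]
  rw [heq] at hmem hle
  rw [← hφ.coe_toReal hmem.1 hmem.2]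
  refine EReal.coe_le_coe_iff.2 ((average_utility_ge hM hφ hx havg hq hqb hL).trans
    (le_trans ?_ hle))
  rw [Finset.mul_sum]
  exact Finset.sum_le_sum fun l _ => mul_le_mul_of_nonneg_left (hjen l).2 (by positivity)

/-- Since `φ` may tend to `-∞`, the error `E[G_i] / L` is removed by compactness: along a
subsequence violating the bound, the received powers tend to `r` and the averaged `γ` to `g ≤ r`, so
monotonicity of `φ` gives a contradiction. -/
theorem utility_sub_le_liminf (hM : IsModel P μ H) (hφ : IsUtility φ) (hx : IsQFWPT P φ x γ)
    (hy : Feasible P μ H y) {q : Fin K → ℝ} {s : ℝ} (hq : IsTarget P μ H x γ q s)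
    (hqb : φ q ≠ ⊥) :
    (((φ q).toReal - (2 * (K : ℝ) + 1) / 2 * P.Ppeak ^ 2 / P.V : ℝ) : EReal)
      ≤ liminf (fun L => φ (avgRecv μ H P.η x L)) atTop := by
  set a : EReal := (((φ q).toReal - (2 * (K : ℝ) + 1) / 2 * P.Ppeak ^ 2 / P.V : ℝ) : EReal) with ha
  refine le_of_forall_lt_imp_le_of_dense fun b hb => ?_
  refine le_liminf_of_le (by isBoundedDefault) ?_
  by_contra hcon
  have hfreq : ∃ᶠ L in atTop, φ (avgRecv μ H P.η x L) < b ∧ 0 < L :=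
    (not_eventually.1 hcon |>.mono fun L h => not_le.1 h).and_eventually (eventually_gt_atTop 0)
  obtain ⟨ψ, hψ, hψb⟩ := extraction_of_frequently_atTop hfreq
  have hp := hx.peakPower hM.peak_pos.le
  let Γ : ℕ → Fin K → ℝ := fun L i =>
    (1 / (L : ℝ)) * ∑ l ∈ Finset.range L, ∫ ω, γ l (hist (path H ω) l) i ∂μ
  have hΓ : ∀ L i, Γ L i ∈ Set.Icc 0 P.Ppeak := fun L i => average_mem_Icc (fun l =>
    integral_mem_Icc (Eventually.of_forall fun ω => ((hx.aux _ l).1 i).1)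
      (Eventually.of_forall fun ω => ((hx.aux _ l).1 i).2)) L
  have hmem : ∀ n, (avgRecv μ H P.η x (ψ n), Γ (ψ n))
      ∈ Set.Icc (0 : (Fin K → ℝ) × (Fin K → ℝ)) (fun _ => P.Ppeak, fun _ => P.Ppeak) := fun n =>
    ⟨⟨fun i => (hM.avgRecv_mem hp _ i).1, fun i => (hΓ _ i).1⟩,
      ⟨fun i => (hM.avgRecv_mem hp _ i).2, fun i => (hΓ _ i).2⟩⟩
  obtain ⟨⟨r, g⟩, -, ρ, hρ, hlim⟩ := isCompact_Icc.tendsto_subseq hmem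
  have hψρ := (hψ.comp hρ).tendsto_atTop
  have hr : Tendsto (fun n => avgRecv μ H P.η x (ψ (ρ n))) atTop (nhds r) :=
    (continuous_fst.tendsto _).comp hlim
  have hg : Tendsto (fun n => Γ (ψ (ρ n))) atTop (nhds g) :=
    (continuous_snd.tendsto _).comp hlim
  obtain ⟨hro, hφr⟩ := hφ.tendsto (fun n i => (hM.avgRecv_mem hp _ i).1) hr
  obtain ⟨hgo, hφg⟩ := hφ.tendsto (fun n i => (hΓ _ i).1) hg
  have hgr : g ≤ r := fun i => by
    have h1 := ((tendsto_pi_nhds.1 hg i).sub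
      ((expected_queueG_div_tendsto hM hφ hx hy i).comp hψρ))
    rw [sub_zero] at h1
    exact le_of_tendsto_of_tendsto h1 (tendsto_pi_nhds.1 hr i)
      (Eventually.of_forall fun n => avgRecv_ge_aux hM hx _ i)
  have h1 : a ≤ φ g := ge_of_tendsto hφg (Eventually.of_forall fun n =>
    map_average_aux_ge hM hφ hx hy.avg_nonneg hq hqb (hψb (ρ n)).2)
  have h2 : φ r ≤ b := le_of_tendsto hφr (Eventually.of_forall fun n => (hψb (ρ n)).1.le)
  exact absurd (h1.trans ((hφ.monotoneOn hgo hro hgr).trans h2)) (not_le.2 hb)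

theorem IsQFWPT.optUtility_sub_le (hM : IsModel P μ H) (hφ : IsUtility φ)
    (hx : IsQFWPT P φ x γ) :
    optUtility P μ H φ - (((2 * (K : ℝ) + 1) / 2 * P.Ppeak ^ 2 / P.V : ℝ) : EReal)
      ≤ liminf (fun L => φ (avgRecv μ H P.η x L)) atTop := by
  rw [EReal.sub_le_iff_le_add (Or.inl (EReal.coe_ne_bot _)) (Or.inl (EReal.coe_ne_top _))]
  refine iSup₂_le fun y hy => le_of_forall_lt_imp_le_of_dense fun b hb => ?_
  obtain ⟨q, s, hq, hbq⟩ := exists_isTarget hM hφ hx hy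
    ((frequently_lt_of_lt_limsup (by isBoundedDefault) hb).mono fun _ h => h.le)
  -- If `φ q = ⊥` then `b = ⊥` and there is nothing to show.
  rcases eq_or_ne (φ q) ⊥ with hqb | hqb
  · rw [le_bot_iff.1 (hbq.trans_eq hqb)]
    exact bot_le
  · have h := utility_sub_le_liminf hM hφ hx hy hq hqb
    rw [EReal.coe_sub, hφ.coe_toReal hq.nonneg hqb,
      EReal.sub_le_iff_le_add (Or.inl (EReal.coe_ne_bot _)) (Or.inl (EReal.coe_ne_top _))] at h
    exact hbq.trans h

end WPT

theorem theorem3 {Ω : Type*} [MeasurableSpace Ω] (μ : Measure Ω) [IsProbabilityMeasure μ]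
    (K M N : ℕ) (hN : 0 < N)
    (P : WPT.Params) (hη : 0 ≤ P.η ∧ P.η ≤ 1) (hPpeak : 0 < P.Ppeak) (hPmin : 0 ≤ P.Pmin)
    (hV : 0 < P.V)
    (H : ℕ → Ω → WPT.Channel K M N)
    (hHmeas : ∀ l, Measurable (H l))
    (hHindep : iIndepFun H μ)
    (hHident : ∀ l, IdentDistrib (H l) (H 0) μ μ)
    (hHpassive : ∀ l, ∀ᵐ ω ∂μ, ∀ (i : Fin K) (v : WPT.Signal N),
      WPT.recvPower P.η (H l ω i) v ≤ ‖v‖ ^ 2)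
    (φ : (Fin K → ℝ) → EReal) (hφ : WPT.IsUtility φ)
    (hfeas : ∃ y : WPT.Causal K M N (WPT.Signal N), WPT.Feasible P μ H y)
    (x : WPT.Causal K M N (WPT.Signal N)) (γ : WPT.Causal K M N (Fin K → ℝ))
    (hx : WPT.IsQFWPT P φ x γ) :
    WPT.Feasible P μ H x ∧
    WPT.optUtility P μ H φ - (((2 * (K : ℝ) + 1) / 2 * P.Ppeak ^ 2 / P.V : ℝ) : EReal)
      ≤ liminf (fun L => φ (WPT.avgRecv μ H P.η x L)) atTop ∧
    limsup (fun L => φ (WPT.avgRecv μ H P.η x L)) atTop ≤ WPT.optUtility P μ H φ := by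
  have hM : WPT.IsModel P μ H :=
    ⟨hη.1, hPpeak, hPmin, hV, hHmeas, hHindep, hHident, hHpassive⟩
  obtain ⟨y, hy⟩ := hfeas
  have hxf := hx.feasible hM hφ hy
  exact ⟨hxf, hx.optUtility_sub_le hM hφ,
    le_iSup₂ (f := fun z (_ : WPT.Feasible P μ H z) =>
      limsup (fun L => φ (WPT.avgRecv μ H P.η z L)) atTop) x hxf⟩
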